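/- Let $F:\mathbb R\to[0,1]$ be a cumulative distribution function which is positive everywhere and Lipschitz. Let $p,q\ge 0$ be integers, $\alpha_1,\dots,\alpha_p,\beta_1,\dots,\beta_q\in\mathbb R$ and $\gamma\in\mathbb R^d$, and assume that every complex root $z$ of the polynomial $1-\sum_{j=1}^q\beta_jz^j$ satisfies $|z|>1$. Let $X=(X_t)_{t\in\mathbb Z}$ be a stationary and ergodic process with values in $\mathbb R^d$, defined on a probability space $(\Omega_0,P_0)$, with $\mathbb E\log_+|X_1|<\infty$. A solution of the model consists of processes $(X'_t,Y_t,\mu_t)_{t\in\mathbb Z}$ on some probability space, with $X'=(X'_t)_{t\in\mathbb Z}$ distributed as $X$, $Y_t\in\{0,1\}$ and $\mu_t\in\mathbb R$, such that almost surely, for all $t\in\mathbb Z$, $$\mathbb P\left(Y_t=1\mid Y_{t-1},Y_{t-2},\dots;X'\right)=F(\mu_t),\qquad \mu_t=\sum_{j=1}^q\beta_j\mu_{t-j}+\sum_{k=1}^p\alpha_kY_{t-k}+\gamma'X'_t.$$ Then the model has a unique stationary solution, in the following sense. There is a solution, defined on the enlargement $\{0,1\}^{\mathbb Z}\times\Omega_0$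 of $(\Omega_0,P_0)$ (with a probability measure whose marginal on $\Omega_0$ is $P_0$, with $Y$ the coordinate process on $\{0,1\}^{\mathbb Z}$ and $X'=X$ read on the second factor), such that $((Y_t,X'_t,\mu_t))_{t\in\mathbb Z}$ is stationary and $((Y_t,X'_t))_{t\in\mathbb Z}$ is stationary and ergodic. Every solution, on any probability space, for which the process $((Y_t,X'_t))_{t\in\mathbb Z}$ is stationary has the same law of $((Y_t,X'_t))_{t\in\mathbb Z}$ as this one; and every solution for which the process $(\mu_t)_{t\in\mathbb Z}$ is stationary has the same law of $((Y_t,X'_t,\mu_t))_{t\in\mathbb Z}$ as this one. In particular, for every such solution the process $((Y_t,X'_t))_{t\in\mathbb Z}$ is stationary and ergodic. -/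

import Mathlib

open MeasureTheory ProbabilityTheory

universe u v

namespace BinaryAutoregression

/-- The time shift `(x_t)_t ↦ (x_{t+1})_t` on two-sided sequences. -/
def shift {S : Type*} (x : ℤ → S) : ℤ → S := fun t => x (t + 1)

/-- The law of a process `(V_t)_{t ∈ ℤ}` on the space of two-sided sequences
(with the product σ-algebra). -/
noncomputable def law {Ω S : Type*} [MeasurableSpace Ω] [MeasurableSpace S]
    (P : Measure Ω) (V : ℤ → Ω → S) : Measure (ℤ → S) :=
  P.map (fun ω t => V t ω)

/-- Strict stationarity: the law of the whole process is invariant under the time shift. -/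
def IsStationary {Ω S : Type*} [MeasurableSpace Ω] [MeasurableSpace S]
    (P : Measure Ω) (V : ℤ → Ω → S) : Prop :=
  (∀ t, Measurable (V t)) ∧ MeasurePreserving shift (law P V) (law P V)

/-- A stationary and ergodic process: the law of the process is invariant under the time shift,
and every shift-invariant event has probability `0` or `1`. -/
def IsStationaryErgodic {Ω S : Type*} [MeasurableSpace Ω] [MeasurableSpace S]
    (P : Measure Ω) (V : ℤ → Ω → S) : Prop :=
  (∀ t, Measurable (V t)) ∧ Ergodic shift (law P V)

/-- The σ-algebra generated by the past values `Y_{t-1}, Y_{t-2}, …` and by the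
whole covariate process `X = (X_s)_{s ∈ ℤ}`. -/
@[reducible] def pastAndCovariates {Ω S S' : Type*} [MeasurableSpace S] [MeasurableSpace S']
    (Y : ℤ → Ω → S) (X : ℤ → Ω → S') (t : ℤ) : MeasurableSpace Ω :=
  (⨆ s : {s : ℤ // s < t}, MeasurableSpace.comap (Y s) inferInstance) ⊔
    ⨆ s : ℤ, MeasurableSpace.comap (X s) inferInstance

/-- On the probability space `(Ω, P)`, the `{0, 1}`-valued process `Y` with latent process `μ` solves
`P(Y_t = 1 | Y_{t-1}, Y_{t-2}, …; X) = F(μ_t)`,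
`μ_t = ∑_{j=1}^q β_j μ_{t-j} + ∑_{k=1}^p α_k Y_{t-k} + γ' X_t`, for all `t ∈ ℤ`. -/
structure IsSolution {d : ℕ} (F : ℝ → ℝ) (q p : ℕ) (β α : ℕ → ℝ) (γ : EuclideanSpace ℝ (Fin d))
    {Ω : Type*} [MeasurableSpace Ω] (P : Measure Ω)
    (X : ℤ → Ω → EuclideanSpace ℝ (Fin d)) (Y : ℤ → Ω → Fin 2) (μ : ℤ → Ω → ℝ) : Prop where
  measurable_covariate : ∀ t, Measurable (X t)
  measurable_response : ∀ t, Measurable (Y t)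
  measurable_latent : ∀ t, Measurable (μ t)
  recursion : ∀ t, ∀ᵐ ω ∂P,
    μ t ω = ∑ j ∈ Finset.Icc 1 q, β j * μ (t - (j : ℤ)) ω
      + ∑ k ∈ Finset.Icc 1 p, α k * ((Y (t - (k : ℤ)) ω : ℕ) : ℝ)
      + inner ℝ γ (X t ω)
  condProb : ∀ t,
    P[Set.indicator {ω | Y t ω = 1} (fun _ => (1 : ℝ)) | pastAndCovariates Y X t]
      =ᵐ[P] fun ω => F (μ t ω)

end BinaryAutoregression

/-!
The roots condition makes the latent process a causal filter of the past responses and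
covariates, with geometrically decaying impulse response. So, given the covariates, the responses
form a chain with complete connections, in a random environment, whose memory decays
geometrically. Blocks of times during which the transition probabilities are bounded below recur,
by Poincaré recurrence, and each of them contracts the influence of the remote past (Doeblin). Hence
for almost every environment there is exactly one chain: existence follows by compactness, and
uniqueness gives stationarity, and also ergodicity, because conditioning on an invariant event
yields another chain in the same environment.

A solution differs from the causal one by a solution of the homogeneous recursion, which tends to
`0` forward in time. If the latent process is stationary, it is bounded along recurrent windows in
the remote past, and the difference vanishes. If only the responses and covariates are stationary,
the defect in the conditional probabilities can be moved forward in time, where it vanishes.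
-/

open Filter Topology

namespace BinaryAutoregression

/-! ### Powers of the companion matrix -/

lemma exists_norm_pow_le_of_spectralRadius_lt_one {A : Type*} [NormedRing A] [NormedAlgebra ℂ A]
    [CompleteSpace A] {a : A} (ha : spectralRadius ℂ a < 1) :
    ∃ C ρ : ℝ, 0 < ρ ∧ ρ < 1 ∧ ∀ n, ‖a ^ n‖ ≤ C * ρ ^ n := by
  obtain ⟨ρ, hρ, hρ1⟩ := ENNReal.lt_iff_exists_nnreal_btwn.1 ha
  have hρ0 : (0 : ℝ) < ρ := by exact_mod_cast (zero_le (a := spectralRadius ℂ a)).trans_lt hρ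
  have hroot : ∀ᶠ n : ℕ in atTop, ‖a ^ n‖ ≤ 1 * ‖(ρ : ℝ) ^ n‖ := by
    filter_upwards [(spectrum.pow_nnnorm_pow_one_div_tendsto_nhds_spectralRadius a).eventually
      (gt_mem_nhds hρ), eventually_gt_atTop 0] with n hn hn0
    have hpow := ENNReal.rpow_le_rpow hn.le (Nat.cast_nonneg n)
    rw [← ENNReal.rpow_mul, one_div_mul_cancel (by positivity), ENNReal.rpow_one,
      ENNReal.rpow_natCast] at hpow
    rw [one_mul, Real.norm_of_nonneg (by positivity)]
    exact_mod_cast hpow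
  obtain ⟨C, -, hC⟩ := Asymptotics.bound_of_isBigO_nat_atTop (Asymptotics.IsBigO.of_bound 1 hroot)
  refine ⟨C, ρ, hρ0, by exact_mod_cast hρ1, fun n => ?_⟩
  simpa [abs_of_pos hρ0] using hC (pow_pos hρ0 n).ne'

/-- The companion matrix of the recursion `s_t = ∑_{j=1}^q β_j s_{t-j}`, acting on the state
`(s_t, …, s_{t-q})`. The state has one entry more than the recursion needs, so that it is
nonempty for `q = 0`. -/
def companion {R : Type*} [Semiring R] (q : ℕ) (β : ℕ → R) :
    Matrix (Fin (q + 1)) (Fin (q + 1)) R :=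
  Matrix.of fun i j => if i = 0 then (if (j : ℕ) < q then β (j + 1) else 0)
    else if (i : ℕ) = j + 1 then 1 else 0

/-- The state `(h_t, …, h_{t-q})` on which the companion matrix acts. -/
def lags {R : Type*} (q : ℕ) (h : ℤ → R) (t : ℤ) : Fin (q + 1) → R := fun i => h (t - (i : ℕ))

section Companion

open Matrix

lemma sum_Icc_one_eq_sum_fin {M : Type*} [AddCommMonoid M] (q : ℕ) (f : ℕ → M) :
    ∑ j ∈ Finset.Icc 1 q, f j = ∑ j : Fin q, f (j + 1) := by
  rw [Fin.sum_univ_eq_sum_range (fun j => f (j + 1)) q, Finset.range_eq_Ico,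
    Finset.sum_Ico_add' f 0 q 1]
  rfl

variable {R : Type*} [Semiring R] {q : ℕ} {β : ℕ → R}

lemma companion_mulVec_zero (v : Fin (q + 1) → R) :
    (companion q β *ᵥ v) 0 = ∑ j : Fin q, β (j + 1) * v j.castSucc := by
  simp [mulVec, dotProduct, Fin.sum_univ_castSucc, companion]

lemma companion_mulVec_succ (v : Fin (q + 1) → R) (i : Fin q) :
    (companion q β *ᵥ v) i.succ = v i.castSucc := by
  rw [mulVec, dotProduct, Finset.sum_eq_single i.castSucc]
  · simp [companion]
  · intro j _ hj
    have hij : ¬ (i : ℕ) = j := fun h => hj (Fin.ext (by simp [h]))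
    simp [companion, hij]
  · simp

lemma map_companion {R' : Type*} [Semiring R'] (φ : R →+* R') :
    (companion q β).map φ = companion q fun j => φ (β j) := by
  ext i j
  simp only [companion, map_apply, of_apply]
  split_ifs <;> simp

lemma lags_eq_companion_mulVec {h : ℤ → R}
    (hh : ∀ t, h t = ∑ j ∈ Finset.Icc 1 q, β j * h (t - (j : ℤ))) (t : ℤ) :
    lags q h t = companion q β *ᵥ lags q h (t - 1) := by
  funext i
  rcases Fin.eq_zero_or_eq_succ i with rfl | ⟨i, rfl⟩
  · rw [companion_mulVec_zero]
    simp only [lags, Fin.val_zero, Nat.cast_zero, sub_zero, Fin.val_castSucc]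
    rw [hh t, sum_Icc_one_eq_sum_fin]
    exact Finset.sum_congr rfl fun j _ => by push_cast; rw [sub_sub, add_comm (j : ℤ)]
  · rw [companion_mulVec_succ]
    simp only [lags, Fin.val_succ, Fin.val_castSucc]
    push_cast
    rw [sub_sub, add_comm]

lemma lags_eq_companion_pow_mulVec {h : ℤ → R}
    (hh : ∀ t, h t = ∑ j ∈ Finset.Icc 1 q, β j * h (t - (j : ℤ))) (t : ℤ) (n : ℕ) :
    lags q h t = companion q β ^ n *ᵥ lags q h (t - n) := by
  induction n with
  | zero => simp
  | succ n ih =>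
    rw [ih, lags_eq_companion_mulVec hh (t - n), mulVec_mulVec, ← pow_succ, sub_sub, Nat.cast_succ]

lemma charPoly_inv_eq_zero_of_companion_mulVec_eq {K : Type*} [Field K] {β : ℕ → K} {k : K}
    {v : Fin (q + 1) → K} (hk : k ≠ 0) (hv : v ≠ 0) (heq : companion q β *ᵥ v = k • v) :
    1 - ∑ j ∈ Finset.Icc 1 q, β j * k⁻¹ ^ j = 0 := by
  have hsucc (i : Fin q) : v i.castSucc = k * v i.succ := by
    rw [← companion_mulVec_succ (β := β) v i, heq, Pi.smul_apply, smul_eq_mul]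
  have hpow (i : Fin (q + 1)) : v i = k⁻¹ ^ (i : ℕ) * v 0 := by
    induction i using Fin.induction with
    | zero => simp
    | succ i ih =>
      rw [Fin.val_succ, pow_succ', mul_assoc, ← Fin.val_castSucc, ← ih, hsucc,
        inv_mul_cancel_left₀ hk]
  have hv0 : v 0 ≠ 0 := fun h => hv (funext fun i => by rw [hpow, h, mul_zero, Pi.zero_apply])
  have hrow : k * v 0 = (∑ j ∈ Finset.Icc 1 q, β j * k⁻¹ ^ j) * (k * v 0) := by
    have hzero : k * v 0 = ∑ j : Fin q, β (j + 1) * v j.castSucc := by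
      rw [← companion_mulVec_zero, heq, Pi.smul_apply, smul_eq_mul]
    rw [sum_Icc_one_eq_sum_fin, Finset.sum_mul, hzero]
    refine Finset.sum_congr rfl fun j _ => ?_
    rw [← hzero, hpow, Fin.val_castSucc, pow_succ]
    field_simp
  rw [sub_eq_zero]
  exact mul_right_cancel₀ (mul_ne_zero hk hv0) (by rw [one_mul]; exact hrow)

lemma norm_lt_one_of_mem_spectrum_companion {β : ℕ → ℂ}
    (hβ : ∀ z : ℂ, 1 - ∑ j ∈ Finset.Icc 1 q, β j * z ^ j = 0 → 1 < ‖z‖) {k : ℂ}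
    (hk : k ∈ spectrum ℂ (companion q β)) : ‖k‖ < 1 := by
  rw [← Matrix.spectrum_toLin', ← Module.End.hasEigenvalue_iff_mem_spectrum] at hk
  obtain ⟨v, hv⟩ := hk.exists_hasEigenvector
  rcases eq_or_ne k 0 with rfl | hk0
  · simp
  have hroot := hβ _ (charPoly_inv_eq_zero_of_companion_mulVec_eq hk0 hv.2
    (by simpa using hv.apply_eq_smul))
  rw [norm_inv] at hroot
  exact (one_lt_inv₀ (norm_pos_iff.2 hk0)).1 hroot

/-- The powers of the companion matrix decay geometrically, entrywise at most `C * ρ ^ n`: the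
quantitative form of the assumption that the roots of `1 - ∑_{j=1}^q β_j z^j` lie outside the
closed unit disc. -/
structure HasPowerDecay (q : ℕ) (β : ℕ → ℝ) (C ρ : ℝ) : Prop where
  rate_pos : 0 < ρ
  rate_lt_one : ρ < 1
  abs_le : ∀ n i j, |(companion q β ^ n) i j| ≤ C * ρ ^ n

lemma HasPowerDecay.const_nonneg {β : ℕ → ℝ} {C ρ : ℝ} (hM : HasPowerDecay q β C ρ) : 0 ≤ C := by
  simpa using (abs_nonneg _).trans (hM.abs_le 0 0 0)

attribute [local instance] Matrix.linftyOpNormedAddCommGroup Matrix.linftyOpNormedRing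
  Matrix.linftyOpNormedAlgebra Matrix.linftyOpNormedSpace in
theorem exists_hasPowerDecay {β : ℕ → ℝ}
    (hβ : ∀ z : ℂ, 1 - ∑ j ∈ Finset.Icc 1 q, (β j : ℂ) * z ^ j = 0 → 1 < ‖z‖) :
    ∃ C ρ : ℝ, HasPowerDecay q β C ρ := by
  set A := companion q fun j => (β j : ℂ)
  have : CompleteSpace (Matrix (Fin (q + 1)) (Fin (q + 1)) ℂ) := FiniteDimensional.complete ℂ _
  have hspec : spectralRadius ℂ A < (1 : NNReal) :=
    spectrum.spectralRadius_lt_of_forall_lt A fun k hk => by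
      exact_mod_cast norm_lt_one_of_mem_spectrum_companion hβ hk
  obtain ⟨C, ρ, hρ0, hρ1, hpow⟩ := exists_norm_pow_le_of_spectralRadius_lt_one hspec
  refine ⟨C, ρ, hρ0, hρ1, fun n i j => ?_⟩
  have hmap : A ^ n = (companion q β ^ n).map Complex.ofRealHom := by
    rw [← RingHom.mapMatrix_apply, map_pow, RingHom.mapMatrix_apply, map_companion]
    rfl
  calc |(companion q β ^ n) i j| = ‖(A ^ n *ᵥ Pi.single j 1) i‖ := by simp [hmap]
    _ ≤ ‖A ^ n *ᵥ Pi.single j 1‖ := norm_le_pi_norm _ i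
    _ ≤ ‖A ^ n‖ * ‖(Pi.single j 1 : Fin (q + 1) → ℂ)‖ := linfty_opNorm_mulVec _ _
    _ = ‖A ^ n‖ := by rw [Pi.norm_single, norm_one, mul_one]
    _ ≤ C * ρ ^ n := hpow n

lemma HasPowerDecay.abs_le_of_homogeneous {β : ℕ → ℝ} {C ρ : ℝ} (hM : HasPowerDecay q β C ρ)
    {h : ℤ → ℝ} (hh : ∀ t, h t = ∑ j ∈ Finset.Icc 1 q, β j * h (t - (j : ℤ))) (t : ℤ) (n : ℕ) :
    |h t| ≤ C * ρ ^ n * ∑ j : Fin (q + 1), |h (t - n - (j : ℕ))| := by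
  have hpow : h t = ∑ j : Fin (q + 1), (companion q β ^ n) 0 j * h (t - n - (j : ℕ)) := by
    simpa [lags, mulVec, dotProduct] using congrFun (lags_eq_companion_pow_mulVec hh t n) 0
  rw [hpow, Finset.mul_sum]
  refine (Finset.abs_sum_le_sum_abs _ _).trans (Finset.sum_le_sum fun j _ => ?_)
  rw [abs_mul]
  exact mul_le_mul_of_nonneg_right (hM.abs_le n 0 j) (abs_nonneg _)

end Companion

section Impulse

variable {q : ℕ} {β : ℕ → ℝ} {C ρ : ℝ} {u : ℤ → ℝ}

/-- The coefficients of the power series `1 / (1 - ∑_{j=1}^q β_j z^j)`, that is, the impulse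
response of the autoregressive recursion. -/
def impulse (q : ℕ) (β : ℕ → ℝ) (n : ℕ) : ℝ := (companion q β ^ n) 0 0

lemma HasPowerDecay.summable_companion_pow_mul (hM : HasPowerDecay q β C ρ) {t : ℤ}
    (hu : Summable fun n : ℕ => ρ ^ n * |u (t - n)|) (i : Fin (q + 1)) :
    Summable fun n : ℕ => (companion q β ^ n) i 0 * u (t - n) :=
  Summable.of_norm_bounded (hu.mul_left C) fun n => by
    rw [Real.norm_eq_abs, abs_mul, ← mul_assoc]
    exact mul_le_mul_of_nonneg_right (hM.abs_le n i 0) (abs_nonneg _)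

-- The `i`-th row of the companion matrix delays the filter by `i` time units.
lemma HasPowerDecay.tsum_companion_pow_mul (hM : HasPowerDecay q β C ρ)
    (hu : ∀ t, Summable fun n : ℕ => ρ ^ n * |u (t - n)|) (i : Fin (q + 1)) (t : ℤ) :
    ∑' n : ℕ, (companion q β ^ n) i 0 * u (t - n)
      = ∑' n : ℕ, impulse q β n * u (t - (i : ℕ) - n) := by
  induction i using Fin.induction generalizing t with
  | zero => simp [impulse]
  | succ i ih =>
    have hentry (n : ℕ) :
        (companion q β ^ (n + 1)) i.succ 0 = (companion q β ^ n) i.castSucc 0 := by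
      rw [pow_succ', Matrix.mul_apply_eq_vecMul]
      exact companion_mulVec_succ (fun j => (companion q β ^ n) j 0) i
    have hdelay : ∑' n : ℕ, (companion q β ^ n) i.succ 0 * u (t - n)
        = ∑' n : ℕ, (companion q β ^ n) i.castSucc 0 * u (t - 1 - n) := by
      rw [(hM.summable_companion_pow_mul (hu t) i.succ).tsum_eq_zero_add]
      simp [hentry, Matrix.one_apply_ne (Fin.succ_ne_zero i), sub_sub, add_comm]
    rw [hdelay, ih]
    simp [sub_sub, add_comm]

theorem HasPowerDecay.tsum_impulse_mul_eq (hM : HasPowerDecay q β C ρ)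
    (hu : ∀ t, Summable fun n : ℕ => ρ ^ n * |u (t - n)|) (t : ℤ) :
    ∑' n : ℕ, impulse q β n * u (t - n)
      = ∑ j ∈ Finset.Icc 1 q, β j * ∑' n : ℕ, impulse q β n * u (t - (j : ℤ) - n) + u t := by
  have hentry (n : ℕ) : impulse q β (n + 1) * u (t - (n + 1 : ℕ))
      = ∑ j : Fin q, β (j + 1) * ((companion q β ^ n) j.castSucc 0 * u (t - 1 - n)) := by
    have hrow : impulse q β (n + 1)
        = ∑ j : Fin q, β (j + 1) * (companion q β ^ n) j.castSucc 0 := by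
      rw [impulse, pow_succ']
      exact companion_mulVec_zero fun j => (companion q β ^ n) j 0
    rw [hrow, Finset.sum_mul, Nat.cast_succ, add_comm (n : ℤ), ← sub_sub]
    exact Finset.sum_congr rfl fun _ _ => mul_assoc _ _ _
  have hsum (j : Fin q) : ∑' n : ℕ, (companion q β ^ n) j.castSucc 0 * u (t - 1 - n)
      = ∑' n : ℕ, impulse q β n * u (t - (j + 1 : ℕ) - n) := by
    rw [hM.tsum_companion_pow_mul hu]
    simp [sub_sub, add_comm]
  have hs : Summable fun n : ℕ => impulse q β n * u (t - n) :=
    hM.summable_companion_pow_mul (hu t) 0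
  rw [hs.tsum_eq_zero_add, tsum_congr hentry, Summable.tsum_finsetSum fun j _ =>
    (hM.summable_companion_pow_mul (hu (t - 1)) _).mul_left _, sum_Icc_one_eq_sum_fin, add_comm]
  congr 1
  · exact Finset.sum_congr rfl fun j _ => by rw [tsum_mul_left, hsum]
  · simp [impulse]

end Impulse

/-! ### Chains with complete connections: loss of memory -/

/-- Averages `f` over the value at time `t`, which is `1` with probability `g`. -/
def averageAt (g : (ℤ → Fin 2) → ℝ) (t : ℤ) (f : (ℤ → Fin 2) → ℝ) (y : ℤ → Fin 2) : ℝ :=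
  g y * f (Function.update y t 1) + (1 - g y) * f (Function.update y t 0)

/-- Averages `f` successively over the values at the times `N - 1, …, N - n`: the conditional
expectation of `f` given the values before time `N - n` under the transition probabilities `g`, if
`f` depends on the values before time `N` only. -/
def backAverage (g : ℤ → (ℤ → Fin 2) → ℝ) (N : ℤ) :
    ℕ → ((ℤ → Fin 2) → ℝ) → (ℤ → Fin 2) → ℝ
  | 0, f => f
  | n + 1, f => averageAt (g (N - (n + 1 : ℕ))) (N - (n + 1 : ℕ)) (backAverage g N n f)

/-- The oscillation of `f` over sequences that agree on `[t - k, t)` is at most `v`. -/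
def OscLE (f : (ℤ → Fin 2) → ℝ) (t : ℤ) (k : ℕ) (v : ℝ) : Prop :=
  ∀ y y' : ℤ → Fin 2, (∀ r, t - k ≤ r → r < t → y r = y' r) → |f y - f y'| ≤ v

/-- Transition probabilities, `g t y` being the probability of the value `1` at time `t` after the
history `y`, with modulus of continuity `b`. -/
structure IsTransition (g : ℤ → (ℤ → Fin 2) → ℝ) (b : ℕ → ℝ) : Prop where
  nonneg : ∀ t y, 0 ≤ g t y
  le_one : ∀ t y, g t y ≤ 1
  osc : ∀ t k, OscLE (g t) t k (b k)

section Oscillation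

variable {g f : (ℤ → Fin 2) → ℝ} {t : ℤ} {k : ℕ} {b v w η : ℝ}

lemma OscLE.mono {k' : ℕ} {v' : ℝ} (h : OscLE f t k v) (hk : k ≤ k') (hv : v ≤ v') :
    OscLE f t k' v' :=
  fun y y' hy => (h y y' fun r h1 h2 => hy r (by omega) h2).trans hv

lemma OscLE.nonneg (h : OscLE f t k v) : 0 ≤ v :=
  (abs_nonneg _).trans (h 0 0 fun _ _ _ => rfl)

lemma OscLE.sub_le (h : OscLE f t 0 v) (y y' : ℤ → Fin 2) : f y - f y' ≤ v :=
  (le_abs_self _).trans (h y y' fun _ h1 h2 => by omega)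

lemma oscLE_of_forall_sub_le
    (h : ∀ y y' : ℤ → Fin 2, (∀ r, t - k ≤ r → r < t → y r = y' r) → f y - f y' ≤ v) :
    OscLE f t k v := fun y y' hy =>
  abs_sub_le_iff.2 ⟨h y y' hy, h y' y fun r h1 h2 => (hy r h1 h2).symm⟩

lemma update_eq_update_of_agree {y y' : ℤ → Fin 2} (hy : ∀ r, t - k ≤ r → r < t → y r = y' r)
    (i : Fin 2) (r : ℤ) (h1 : t + 1 - (k + 1 : ℕ) ≤ r) (h2 : r < t + 1) :
    Function.update y t i r = Function.update y' t i r := by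
  rcases eq_or_ne r t with rfl | h
  · simp
  · simpa [Function.update_of_ne h] using hy r (by push_cast at h1; omega) (by omega)

lemma bernoulli_average_sub_le {p p' a₀ a₁ a₀' a₁' : ℝ} (hp0 : 0 ≤ p) (hp1 : p ≤ 1)
    (hp : p - p' ≤ b) (hb : p' - p ≤ b) (h1 : a₁ - a₁' ≤ v) (h0 : a₀ - a₀' ≤ v)
    (h10 : a₁' - a₀' ≤ w) (h01 : a₀' - a₁' ≤ w) :
    p * a₁ + (1 - p) * a₀ - (p' * a₁' + (1 - p') * a₀') ≤ v + b * w := by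
  have hcross : (p - p') * (a₁' - a₀') ≤ b * w := (le_abs_self _).trans <| by
    rw [abs_mul]
    exact mul_le_mul (abs_le.2 ⟨by linarith, hp⟩) (abs_le.2 ⟨by linarith, h10⟩) (abs_nonneg _)
      (by linarith)
  linarith [mul_le_mul_of_nonneg_left h1 hp0, mul_le_mul_of_nonneg_left h0 (sub_nonneg.2 hp1)]

-- In the maximal coupling of the two Bernoulli laws both variables are `1` with probability at
-- least `η`.
lemma bernoulli_average_sub_le_of_le {p p' a₀ a₁ a₀' a₁' : ℝ} (hη : 0 ≤ η)
    (hp : η ≤ p) (hp1 : p ≤ 1) (hp' : η ≤ p') (hp1' : p' ≤ 1) (h11 : a₁ - a₁' ≤ v)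
    (w11 : a₁ - a₁' ≤ w) (w10 : a₁ - a₀' ≤ w) (w01 : a₀ - a₁' ≤ w) (w00 : a₀ - a₀' ≤ w) :
    p * a₁ + (1 - p) * a₀ - (p' * a₁' + (1 - p') * a₀') ≤ η * v + (1 - η) * w := by
  rcases le_total p p' with h | h
  · linarith [mul_le_mul_of_nonneg_left h11 hη, mul_le_mul_of_nonneg_left w11 (sub_nonneg.2 hp),
      mul_le_mul_of_nonneg_left w01 (sub_nonneg.2 h),
      mul_le_mul_of_nonneg_left w00 (sub_nonneg.2 hp1')]
  · linarith [mul_le_mul_of_nonneg_left h11 hη, mul_le_mul_of_nonneg_left w11 (sub_nonneg.2 hp'),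
      mul_le_mul_of_nonneg_left w10 (sub_nonneg.2 h),
      mul_le_mul_of_nonneg_left w00 (sub_nonneg.2 hp1)]

lemma OscLE.averageAt (h0 : ∀ y, 0 ≤ g y) (h1 : ∀ y, g y ≤ 1) (hg : OscLE g t k b)
    (hv : OscLE f (t + 1) (k + 1) v) (hw : OscLE f (t + 1) 0 w) :
    OscLE (averageAt g t f) t k (v + b * w) :=
  oscLE_of_forall_sub_le fun y y' hy => by
    have hfv (i : Fin 2) := hv _ _ (update_eq_update_of_agree hy i)
    obtain ⟨hgy, hgy'⟩ := abs_sub_le_iff.1 (hg y y' hy)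
    exact bernoulli_average_sub_le (h0 y) (h1 y) hgy hgy' ((le_abs_self _).trans (hfv 1))
      ((le_abs_self _).trans (hfv 0)) (hw.sub_le _ _) (hw.sub_le _ _)

lemma OscLE.averageAt_doeblin (hη : 0 ≤ η) (h0 : ∀ y, η ≤ g y) (h1 : ∀ y, g y ≤ 1)
    (hv : OscLE f (t + 1) (k + 1) v) (hw : OscLE f (t + 1) 0 w) :
    OscLE (BinaryAutoregression.averageAt g t f) t k (η * v + (1 - η) * w) :=
  oscLE_of_forall_sub_le fun y y' hy =>
    bernoulli_average_sub_le_of_le hη (h0 y) (h1 y) (h0 y') (h1 y')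
      ((le_abs_self _).trans (hv _ _ (update_eq_update_of_agree hy 1)))
      (hw.sub_le _ _) (hw.sub_le _ _) (hw.sub_le _ _) (hw.sub_le _ _)

end Oscillation

section LossOfMemory

variable {g : ℤ → (ℤ → Fin 2) → ℝ} {b : ℕ → ℝ} {N : ℤ} {f : (ℤ → Fin 2) → ℝ} {n : ℕ} {v w δ : ℝ}

lemma OscLE.backAverage_succ (hg : IsTransition g b) {k : ℕ}
    (hv : OscLE (backAverage g N n f) (N - n) (k + 1) v)
    (hw : OscLE (backAverage g N n f) (N - n) 0 w) :
    OscLE (backAverage g N (n + 1) f) (N - (n + 1 : ℕ)) k (v + b k * w) := by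
  rw [show N - (n : ℤ) = N - (n + 1 : ℕ) + 1 by push_cast; ring] at hv hw
  exact OscLE.averageAt (hg.nonneg _) (hg.le_one _) (hg.osc _ k) hv hw

lemma OscLE.backAverage_succ_doeblin (hg : IsTransition g b) {k : ℕ} (hδ : 0 ≤ δ)
    (hδg : ∀ y, δ ≤ g (N - (n + 1 : ℕ)) y)
    (hv : OscLE (backAverage g N n f) (N - n) (k + 1) v)
    (hw : OscLE (backAverage g N n f) (N - n) 0 w) :
    OscLE (backAverage g N (n + 1) f) (N - (n + 1 : ℕ)) k (δ * v + (1 - δ) * w) := by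
  rw [show N - (n : ℤ) = N - (n + 1 : ℕ) + 1 by push_cast; ring] at hv hw
  exact OscLE.averageAt_doeblin hδ hδg (hg.le_one _) hv hw

lemma OscLE.backAverage_add_zero (hg : IsTransition g b)
    (hw : OscLE (backAverage g N n f) (N - n) 0 w) (j : ℕ) :
    OscLE (backAverage g N (n + j) f) (N - (n + j : ℕ)) 0 w := by
  induction j with
  | zero => exact hw
  | succ j ih =>
    simpa [add_assoc] using
      OscLE.backAverage_succ_doeblin hg le_rfl (hg.nonneg _) (ih.mono zero_le_one le_rfl) ih

lemma OscLE.backAverage_add (hg : IsTransition g b)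
    (hw : OscLE (backAverage g N n f) (N - n) 0 w) (j k : ℕ)
    (hv : OscLE (backAverage g N n f) (N - n) (k + j) v) :
    OscLE (backAverage g N (n + j) f) (N - (n + j : ℕ)) k
      (v + (∑ i ∈ Finset.range j, b (k + i)) * w) := by
  induction j generalizing k with
  | zero => simpa using hv
  | succ j ih =>
    have hstep := OscLE.backAverage_succ hg (ih (k + 1) (by rwa [add_right_comm, add_assoc]))
      (hw.backAverage_add_zero hg j)
    refine hstep.mono le_rfl (le_of_eq ?_)
    simp only [Finset.sum_range_succ', add_comm, add_left_comm, add_zero]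
    ring

lemma OscLE.backAverage_add_doeblin (hg : IsTransition g b) (hδ : 0 ≤ δ)
    (hw : OscLE (backAverage g N n f) (N - n) 0 w) (j k : ℕ)
    (hwin : ∀ r, N - (n + j : ℕ) ≤ r → r < N - n → ∀ y, δ ≤ g r y)
    (hv : OscLE (backAverage g N n f) (N - n) (k + j) v) :
    OscLE (backAverage g N (n + j) f) (N - (n + j : ℕ)) k (δ ^ j * v + (1 - δ ^ j) * w) := by
  induction j generalizing k with
  | zero => simpa using hv
  | succ j ih =>
    have hstep := OscLE.backAverage_succ_doeblin hg hδ
      (hwin (N - (n + j + 1 : ℕ)) le_rfl (by push_cast; omega))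
      (ih (k + 1) (fun r hr => hwin r (by push_cast at hr ⊢; omega))
        (by rwa [add_right_comm, add_assoc]))
      (hw.backAverage_add_zero hg j)
    exact hstep.mono le_rfl (le_of_eq (by ring))

lemma exists_oscLE_backAverage (hg : IsTransition g b) (hb : Tendsto b atTop (𝓝 0))
    (hw : OscLE f N 0 w) (hf : ∀ ε > 0, ∃ K, OscLE f N K ε) (n : ℕ) (ε : ℝ) (hε : 0 < ε) :
    ∃ K, OscLE (backAverage g N n f) (N - n) K ε := by
  induction n generalizing ε with
  | zero => simpa [backAverage] using hf ε hε
  | succ n ih =>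
    have hosc : OscLE (backAverage g N n f) (N - n) 0 w := by
      simpa using OscLE.backAverage_add_zero (n := 0) hg (by simpa [backAverage] using hw) n
    obtain ⟨K, hK⟩ := ih (ε / 2) (half_pos hε)
    have hlim : Tendsto (fun k => b k * w) atTop (𝓝 0) := by simpa using hb.mul_const w
    obtain ⟨K', hK', hKK⟩ := ((hlim.eventually (ge_mem_nhds (half_pos hε))).and
      (eventually_ge_atTop K)).exists
    exact ⟨K', (OscLE.backAverage_succ hg (hK.mono (hKK.trans K'.le_succ) le_rfl) hosc).mono le_rfl
      (by linarith)⟩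

-- Going back until the oscillation over sequences agreeing on a long stretch is at most `v / 4`
-- and then through a window, the first bound for the oscillation given the window is `3 v / 4`,
-- and the Doeblin condition on the window turns it into a contraction.
lemma exists_oscLE_backAverage_contract (hg : IsTransition g b) {m : ℕ}
    (hm : ∀ j, ∑ i ∈ Finset.range j, b (m + i) ≤ 1 / 2) (hδ : 0 ≤ δ)
    (hwin : ∀ T : ℤ, ∃ s < T, ∀ r, s ≤ r → r < s + m → ∀ y, δ ≤ g r y)
    (hn : OscLE (backAverage g N n f) (N - n) 0 v)
    (hsmall : ∃ K, OscLE (backAverage g N n f) (N - n) K (v / 4)) :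
    ∃ n, OscLE (backAverage g N n f) (N - n) 0 (v * (1 - δ ^ m / 4)) := by
  obtain ⟨K, hK⟩ := hsmall
  obtain ⟨s, hs, hsw⟩ := hwin (N - n - K - m)
  obtain ⟨j, hj⟩ := Int.eq_ofNat_of_zero_le (show 0 ≤ N - n - m - s by omega)
  have hbefore : OscLE (backAverage g N (n + j) f) (N - (n + j : ℕ)) (0 + m) (3 / 4 * v) := by
    refine (hn.backAverage_add hg j m (hK.mono (by omega) le_rfl)).mono (by omega) ?_
    linarith [mul_le_mul_of_nonneg_right (hm j) hn.nonneg]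
  refine ⟨_, (OscLE.backAverage_add_doeblin hg hδ (hn.backAverage_add_zero hg j) m 0
    (fun r h1 h2 => hsw r ?_ ?_) hbefore).mono le_rfl (le_of_eq (by ring))⟩
  · push_cast at h1; omega
  · push_cast at h2; omega

theorem exists_forall_ge_oscLE_backAverage (hg : IsTransition g b) (hb : Tendsto b atTop (𝓝 0))
    {m : ℕ} (hm : ∀ j, ∑ i ∈ Finset.range j, b (m + i) ≤ 1 / 2)
    (hwin : ∃ δ > 0, ∀ T : ℤ, ∃ s < T, ∀ r, s ≤ r → r < s + m → ∀ y, δ ≤ g r y)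
    (hw : OscLE f N 0 w) (hf : ∀ ε > 0, ∃ K, OscLE f N K ε) (ε : ℝ) (hε : 0 < ε) :
    ∃ n₀, ∀ n ≥ n₀, OscLE (backAverage g N n f) (N - n) 0 ε := by
  obtain ⟨δ₁, hδ₁, hwin⟩ := hwin
  obtain ⟨δ, hδ, hδ1, hδδ⟩ : ∃ δ : ℝ, 0 < δ ∧ δ ≤ 1 ∧ δ ≤ δ₁ :=
    ⟨min δ₁ 1, lt_min hδ₁ one_pos, min_le_right _ _, min_le_left _ _⟩
  replace hwin (T : ℤ) : ∃ s < T, ∀ r, s ≤ r → r < s + m → ∀ y, δ ≤ g r y :=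
    (hwin T).imp fun s hs => ⟨hs.1, fun r h1 h2 y => hδδ.trans (hs.2 r h1 h2 y)⟩
  have hpow : 0 < δ ^ m := pow_pos hδ m
  have hpow1 : δ ^ m ≤ 1 := pow_le_one₀ hδ.le hδ1
  have hw1 : 0 < w + 1 := by linarith [hw.nonneg]
  have iterate (i : ℕ) :
      ∃ n, OscLE (backAverage g N n f) (N - n) 0 ((w + 1) * (1 - δ ^ m / 4) ^ i) := by
    induction i with
    | zero => exact ⟨0, by simpa [backAverage] using hw.mono le_rfl (by linarith)⟩
    | succ i ih =>
      obtain ⟨n, hn⟩ := ih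
      have hpos : 0 < (w + 1) * (1 - δ ^ m / 4) ^ i := mul_pos hw1 (pow_pos (by linarith) i)
      rw [pow_succ, ← mul_assoc]
      exact exists_oscLE_backAverage_contract hg hm hδ.le hwin hn
        (exists_oscLE_backAverage hg hb hw hf n _ (by positivity))
  have hlim : Tendsto (fun i : ℕ => (w + 1) * (1 - δ ^ m / 4) ^ i) atTop (𝓝 0) := by
    simpa using (tendsto_pow_atTop_nhds_zero_of_lt_one (r := 1 - δ ^ m / 4)
      (by linarith) (by linarith)).const_mul (w + 1)
  obtain ⟨i, hi⟩ := (hlim.eventually (ge_mem_nhds hε)).exists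
  obtain ⟨n, hn⟩ := iterate i
  refine ⟨n, fun n' hn' => ?_⟩
  obtain ⟨j, rfl⟩ := Nat.exists_eq_add_of_le hn'
  exact (hn.backAverage_add_zero hg j).mono le_rfl hi

end LossOfMemory

/-! ### Existence of chains with given transition probabilities -/

section DependsOn

variable {f g : (ℤ → Fin 2) → ℝ} {s t : ℤ}

lemma dependsOn_Iio_mono (hf : DependsOn f (Set.Iio s)) (h : s ≤ t) : DependsOn f (Set.Iio t) :=
  fun _ _ hy => hf fun r hr => hy r (lt_of_lt_of_le hr h)

lemma continuous_of_oscLE (hf : ∀ ε > 0, ∃ K, OscLE f t K ε) : Continuous f := by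
  refine continuous_iff_continuousAt.2 fun y => Metric.continuousAt_iff'.2 fun ε hε => ?_
  obtain ⟨K, hK⟩ := hf (ε / 2) (half_pos hε)
  have hagree : ∀ᶠ y' in 𝓝 y, ∀ r ∈ Finset.Ico (t - K) t, y' r = y r :=
    (eventually_all_finset _).2 fun r _ => by
      simpa [nhds_discrete] using (continuous_apply (A := fun _ : ℤ => Fin 2) r).tendsto y
  filter_upwards [hagree] with y' hy'
  exact (hK y' y fun r h1 h2 => hy' r (Finset.mem_Ico.2 ⟨h1, h2⟩)).trans_lt (half_lt_self hε)

lemma dependsOn_of_oscLE (hf : ∀ ε > 0, ∃ K, OscLE f t K ε) : DependsOn f (Set.Iio t) := by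
  refine fun y y' h => sub_eq_zero.1 (abs_eq_zero.1 (le_antisymm ?_ (abs_nonneg _)))
  refine le_of_forall_pos_le_add fun ε hε => ?_
  obtain ⟨K, hK⟩ := hf ε hε
  simpa using hK y y' fun r _ h2 => h r h2

lemma continuous_averageAt (hg : Continuous g) (hf : Continuous f) (t : ℤ) :
    Continuous (averageAt g t f) := by
  have hupdate (i : Fin 2) : Continuous fun y : ℤ → Fin 2 => f (Function.update y t i) :=
    hf.comp (continuous_id.update t continuous_const)
  exact (hg.mul (hupdate 1)).add ((continuous_const.sub hg).mul (hupdate 0))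

lemma dependsOn_comp_update (hf : DependsOn f (Set.Iio (t + 1))) (i : Fin 2) :
    DependsOn (fun y => f (Function.update y t i)) (Set.Iio t) := fun y y' h =>
  hf fun r hr => by
    rcases eq_or_ne r t with rfl | hrt
    · simp
    · simpa only [Function.update_of_ne hrt] using
        h r (lt_of_le_of_ne (Int.lt_add_one_iff.1 hr) hrt)

lemma dependsOn_averageAt (hg : DependsOn g (Set.Iio t)) (hf : DependsOn f (Set.Iio (t + 1))) :
    DependsOn (averageAt g t f) (Set.Iio t) := fun y y' h => by
  simp only [averageAt, hg h, dependsOn_comp_update hf 0 h, dependsOn_comp_update hf 1 h]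

lemma averageAt_of_dependsOn (g : (ℤ → Fin 2) → ℝ) (hf : DependsOn f (Set.Iio t)) :
    averageAt g t f = f := by
  funext y
  have hupdate (i : Fin 2) : f (Function.update y t i) = f y :=
    hf fun r hr => Function.update_of_ne (ne_of_lt hr) _ _
  simp only [averageAt, hupdate]
  ring

end DependsOn

/-- `κ` is the law of a process whose conditional probability of the value `1` at each time `t`
given the values before time `t` is `g t`. The condition is tested on continuous functions, so
that it passes to weak limits. -/
def IsChainLaw (g : ℤ → (ℤ → Fin 2) → ℝ) (κ : Measure (ℤ → Fin 2)) : Prop :=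
  ∀ t, ∀ f : (ℤ → Fin 2) → ℝ, Continuous f → DependsOn f (Set.Iio (t + 1)) →
    ∫ y, f y ∂κ = ∫ y, averageAt (g t) t f y ∂κ

section BackAverage

variable {g : ℤ → (ℤ → Fin 2) → ℝ} {N t : ℤ} {f : (ℤ → Fin 2) → ℝ} {n : ℕ}

lemma continuous_backAverage (hg : ∀ t, Continuous (g t)) (N : ℤ) (hf : Continuous f) (n : ℕ) :
    Continuous (backAverage g N n f) := by
  induction n with
  | zero => exact hf
  | succ n ih => exact continuous_averageAt (hg _) ih _

lemma dependsOn_backAverage (hg : ∀ t, DependsOn (g t) (Set.Iio t))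
    (hf : DependsOn f (Set.Iio N)) (n : ℕ) :
    DependsOn (backAverage g N n f) (Set.Iio (N - n)) := by
  induction n with
  | zero => simpa [backAverage] using hf
  | succ n ih => exact dependsOn_averageAt (hg _) (dependsOn_Iio_mono ih (by push_cast; omega))

lemma backAverage_of_dependsOn (hf : DependsOn f (Set.Iio (N - n))) : backAverage g N n f = f := by
  induction n with
  | zero => rfl
  | succ n ih =>
    rw [backAverage, ih (dependsOn_Iio_mono hf (by push_cast; omega)), averageAt_of_dependsOn _ hf]

lemma backAverage_add_congr {f' : (ℤ → Fin 2) → ℝ} (h : backAverage g N n f = backAverage g N n f')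
    (i : ℕ) : backAverage g N (n + i) f = backAverage g N (n + i) f' := by
  induction i with
  | zero => exact h
  | succ i ih => rw [← add_assoc, backAverage, backAverage, ih]

lemma backAverage_averageAt (hg : ∀ t, DependsOn (g t) (Set.Iio t)) (h1 : t < N) (h2 : N - n ≤ t)
    (hf : DependsOn f (Set.Iio (t + 1))) :
    backAverage g N n (averageAt (g t) t f) = backAverage g N n f := by
  obtain ⟨j, hj⟩ := Int.eq_ofNat_of_zero_le (show 0 ≤ N - (t + 1) by omega)
  obtain ⟨i, rfl⟩ := Nat.exists_eq_add_of_le (show j + 1 ≤ n by omega)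
  obtain rfl : t = N - (j + 1 : ℕ) := by push_cast; omega
  refine backAverage_add_congr ?_ i
  rw [backAverage_of_dependsOn (dependsOn_averageAt (hg _) hf), backAverage,
    backAverage_of_dependsOn (dependsOn_Iio_mono hf (by push_cast; omega))]

lemma exists_integral_eq_backAverage (h0 : ∀ t y, 0 ≤ g t y) (h1 : ∀ t y, g t y ≤ 1) (N : ℤ)
    (n : ℕ) (y : ℤ → Fin 2) : ∃ κ : ProbabilityMeasure (ℤ → Fin 2),
      ∀ f : (ℤ → Fin 2) → ℝ, Continuous f → ∫ z, f z ∂(κ : Measure _) = backAverage g N n f y := by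
  induction n generalizing y with
  | zero => exact ⟨⟨Measure.dirac y, inferInstance⟩, fun f _ => by simp [backAverage]⟩
  | succ n ih =>
    set t := N - ((n + 1 : ℕ) : ℤ)
    obtain ⟨κ₁, hκ₁⟩ := ih (Function.update y t 1)
    obtain ⟨κ₀, hκ₀⟩ := ih (Function.update y t 0)
    have h1' : 0 ≤ 1 - g t y := sub_nonneg.2 (h1 t y)
    have hprob : IsProbabilityMeasure (ENNReal.ofReal (g t y) • (κ₁ : Measure (ℤ → Fin 2))
        + ENNReal.ofReal (1 - g t y) • (κ₀ : Measure (ℤ → Fin 2))) := by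
      constructor
      simp [← ENNReal.ofReal_add (h0 t y) h1']
    refine ⟨⟨_, hprob⟩, fun f hf => ?_⟩
    have hint (κ : ProbabilityMeasure (ℤ → Fin 2)) : Integrable f (κ : Measure _) :=
      hf.integrable_of_hasCompactSupport (HasCompactSupport.of_compactSpace f)
    rw [ProbabilityMeasure.coe_mk, integral_add_measure
      ((hint κ₁).smul_measure ENNReal.ofReal_ne_top) ((hint κ₀).smul_measure ENNReal.ofReal_ne_top),
      integral_smul_measure, integral_smul_measure, hκ₁ f hf, hκ₀ f hf,
      ENNReal.toReal_ofReal (h0 t y), ENNReal.toReal_ofReal h1']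
    rfl

-- The law is a weak limit point of the laws of the chains started at time `-n` with the past `0`.
theorem exists_isChainLaw (h0 : ∀ t y, 0 ≤ g t y) (h1 : ∀ t y, g t y ≤ 1)
    (hc : ∀ t, Continuous (g t)) (hg : ∀ t, DependsOn (g t) (Set.Iio t)) :
    ∃ κ : Measure (ℤ → Fin 2), IsProbabilityMeasure κ ∧ IsChainLaw g κ := by
  choose κ hκ using fun n : ℕ => exists_integral_eq_backAverage h0 h1 n (2 * n) 0
  obtain ⟨κ', -, hlim⟩ := isCompact_univ.ultrafilter_le_nhds ((hyperfilter ℕ).map κ) (by simp)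
  have hint (f : (ℤ → Fin 2) → ℝ) (hf : Continuous f) :
      Tendsto (fun n : ℕ => backAverage g n (2 * n) f 0) (hyperfilter ℕ)
        (𝓝 (∫ y, f y ∂(κ' : Measure _))) := by
    simpa [hκ _ f hf] using (ProbabilityMeasure.tendsto_iff_forall_integral_tendsto.1 hlim)
      (BoundedContinuousFunction.mkOfCompact ⟨f, hf⟩)
  refine ⟨κ', inferInstance, fun t f hf hft =>
    tendsto_nhds_unique_of_eventuallyEq (hint f hf) (hint _ (continuous_averageAt (hc t) hf t)) ?_⟩
  have heq : ∀ᶠ n : ℕ in atTop,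
      backAverage g n (2 * n) f 0 = backAverage g n (2 * n) (averageAt (g t) t f) 0 := by
    filter_upwards [eventually_gt_atTop t.natAbs] with n hn
    rw [backAverage_averageAt hg (by omega) (by push_cast; omega) hft]
  exact heq.filter_mono Nat.hyperfilter_le_atTop

lemma IsChainLaw.integral_eq_integral_backAverage {κ : Measure (ℤ → Fin 2)}
    (hκ : IsChainLaw g κ) (hc : ∀ t, Continuous (g t)) (hg : ∀ t, DependsOn (g t) (Set.Iio t))
    (hf : Continuous f) (hfN : DependsOn f (Set.Iio N)) (n : ℕ) :
    ∫ y, f y ∂κ = ∫ y, backAverage g N n f y ∂κ := by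
  induction n with
  | zero => rfl
  | succ n ih =>
    rw [ih]
    exact hκ _ _ (continuous_backAverage hc N hf n)
      (dependsOn_Iio_mono (dependsOn_backAverage hg hfN n) (by push_cast; omega))

end BackAverage

section Trunc

variable {t : ℤ}

/-- The sequence with all values from time `t` on replaced by `0`: it makes a function of the
history before time `t` out of any function on sequences. -/
def trunc (t : ℤ) (y : ℤ → Fin 2) : ℤ → Fin 2 := fun r => if r < t then y r else 0

lemma dependsOn_trunc (t : ℤ) : DependsOn (trunc t) (Set.Iio t) := by
  intro y y' h
  funext r
  by_cases hr : r < t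
  · simp [trunc, hr, h r hr]
  · simp [trunc, hr]

lemma trunc_update (t : ℤ) (y : ℤ → Fin 2) (i : Fin 2) :
    trunc t (Function.update y t i) = trunc t y :=
  dependsOn_trunc t fun _ hr => Function.update_of_ne (ne_of_lt hr) _ _

lemma apply_trunc_of_dependsOn {R : Type*} {f : (ℤ → Fin 2) → R} (hf : DependsOn f (Set.Iio t))
    (y : ℤ → Fin 2) : f (trunc t y) = f y :=
  hf fun _ hr => if_pos hr

lemma continuous_trunc (t : ℤ) : Continuous (trunc t) := by
  refine continuous_pi fun r => ?_
  by_cases hr : r < t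
  · simpa [trunc, hr] using continuous_apply r
  · simp [trunc, hr, continuous_const]

lemma measurable_trunc (t : ℤ) : Measurable (trunc t) := by
  refine measurable_pi_lambda _ fun r => ?_
  by_cases hr : r < t
  · simpa [trunc, hr] using measurable_pi_apply r
  · simp [trunc, hr]

lemma continuous_val_apply (t : ℤ) : Continuous fun y : ℤ → Fin 2 => ((y t : ℕ) : ℝ) :=
  (continuous_of_discreteTopology (f := fun i : Fin 2 => ((i : ℕ) : ℝ))).comp (continuous_apply t)

lemma val_apply_le_one (t : ℤ) (y : ℤ → Fin 2) : ((y t : ℕ) : ℝ) ≤ 1 := by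
  exact_mod_cast Nat.lt_succ_iff.1 (y t).2

lemma integral_comp_mul_eq_of_forall_continuous {α β : Type*} [MeasurableSpace α]
    [TopologicalSpace β] [MeasurableSpace β] [BorelSpace β] [HasOuterApproxClosed β]
    {κ : Measure α} [IsFiniteMeasure κ] {T : α → β} (hT : Measurable T) {p p' : α → ℝ}
    (hp : Measurable p) (hp' : Measurable p') (hp0 : ∀ a, 0 ≤ p a) (hp0' : ∀ a, 0 ≤ p' a)
    (hp1 : ∀ a, p a ≤ 1) (hp1' : ∀ a, p' a ≤ 1)
    (heq : ∀ f : β → ℝ, Continuous f → ∫ a, f (T a) * p a ∂κ = ∫ a, f (T a) * p' a ∂κ)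
    {h : β → ℝ} (hh : Measurable h) :
    ∫ a, h (T a) * p a ∂κ = ∫ a, h (T a) * p' a ∂κ := by
  have hfin {r : α → ℝ} (hr : ∀ a, r a ≤ 1) :
      IsFiniteMeasure (κ.withDensity fun a => ENNReal.ofReal (r a)) :=
    isFiniteMeasure_withDensity (ne_of_lt <|
      (lintegral_mono fun a => ENNReal.ofReal_le_one.2 (hr a)).trans_lt (by simp))
  have := hfin hp1
  have := hfin hp1'
  have hint {r : α → ℝ} (hr : Measurable r) (hr0 : ∀ a, 0 ≤ r a) {h : β → ℝ}
      (hh : Measurable h) : ∫ b, h b ∂((κ.withDensity fun a => ENNReal.ofReal (r a)).map T)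
        = ∫ a, h (T a) * r a ∂κ := by
    rw [integral_map hT.aemeasurable hh.aestronglyMeasurable,
      integral_withDensity_eq_integral_toReal_smul hr.ennreal_ofReal (by simp)]
    simp only [smul_eq_mul, ENNReal.toReal_ofReal (hr0 _), mul_comm]
  have hmap : (κ.withDensity fun a => ENNReal.ofReal (p a)).map T
      = (κ.withDensity fun a => ENNReal.ofReal (p' a)).map T :=
    ext_of_forall_integral_eq_of_IsFiniteMeasure fun f => by
      rw [hint hp hp0 f.continuous.measurable, hint hp' hp0' f.continuous.measurable]
      exact heq f f.continuous
  rw [← hint hp hp0 hh, ← hint hp' hp0' hh, hmap]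

lemma IsChainLaw.integral_comp_trunc_mul {g : ℤ → (ℤ → Fin 2) → ℝ} {κ : Measure (ℤ → Fin 2)}
    [IsFiniteMeasure κ] (hκ : IsChainLaw g κ) (h0 : ∀ t y, 0 ≤ g t y) (h1 : ∀ t y, g t y ≤ 1)
    (hc : ∀ t, Continuous (g t)) (t : ℤ) {h : (ℤ → Fin 2) → ℝ} (hh : Measurable h) :
    ∫ y, h (trunc t y) * ((y t : ℕ) : ℝ) ∂κ = ∫ y, h (trunc t y) * g t y ∂κ := by
  refine integral_comp_mul_eq_of_forall_continuous (measurable_trunc t)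
    (continuous_val_apply t).measurable (hc t).measurable (fun y => Nat.cast_nonneg _) (h0 t)
    (val_apply_le_one t) (h1 t) (fun f hf => ?_) hh
  have hdep : DependsOn (fun y => f (trunc t y) * ((y t : ℕ) : ℝ)) (Set.Iio (t + 1)) := by
    intro y y' hy
    have htrunc : trunc t y = trunc t y' :=
      dependsOn_trunc t fun r hr => hy r (lt_trans hr (lt_add_one t))
    simp only [htrunc, hy t (lt_add_one t)]
  rw [hκ t (fun y => f (trunc t y) * ((y t : ℕ) : ℝ))
    ((hf.comp (continuous_trunc t)).mul (continuous_val_apply t)) hdep]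
  simp [averageAt, trunc_update, mul_comm]

lemma exists_oscLE_indicator_cylinder {C : Set (ℤ → Fin 2)}
    (hC : C ∈ measurableCylinders fun _ => Fin 2) :
    ∃ (N : ℤ) (K : ℕ), OscLE (C.indicator 1) N K 0 := by
  obtain ⟨s, S, -, rfl⟩ := (mem_measurableCylinders C).1 hC
  have hM (r : ℤ) (hr : r ∈ s) : r.natAbs ≤ s.sup Int.natAbs := Finset.le_sup hr
  set M := s.sup Int.natAbs
  refine ⟨M + 1, 2 * M + 1, fun y y' hy => ?_⟩
  have hrestrict : s.restrict y = s.restrict y' := funext fun ⟨r, hr⟩ => by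
    have := hM r hr
    exact hy r (by push_cast; omega) (by omega)
  have hmem : y ∈ cylinder s S ↔ y' ∈ cylinder s S := by
    rw [mem_cylinder, mem_cylinder, hrestrict]
  rw [Set.indicator_eq_indicator (f := 1) (g := 1) hmem rfl, sub_self, abs_zero]

end Trunc

/-! ### Recurrence of the shift -/

section Shift

variable {S : Type*} [MeasurableSpace S]

/-- The time shift as a measurable equivalence. -/
def shiftEquiv (S : Type*) [MeasurableSpace S] : (ℤ → S) ≃ᵐ (ℤ → S) where
  toFun := shift
  invFun x := fun t => x (t - 1)
  left_inv x := by funext t; simp [shift]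
  right_inv x := by funext t; simp [shift]
  measurable_toFun := measurable_pi_lambda _ fun _ => measurable_pi_apply _
  measurable_invFun := measurable_pi_lambda _ fun _ => measurable_pi_apply _

lemma measurable_shift : Measurable (shift : (ℤ → S) → ℤ → S) := (shiftEquiv S).measurable

variable {π : Measure (ℤ → S)}

lemma measure_coordinate_eq (hπ : MeasurePreserving shift π π) {B : Set S} (hB : MeasurableSet B)
    (s t : ℤ) : π {x | x s ∈ B} = π {x | x t ∈ B} := by
  have hsucc (t : ℤ) : π {x | x (t + 1) ∈ B} = π {x | x t ∈ B} :=
    hπ.measure_preimage ((measurable_pi_apply t) hB).nullMeasurableSet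
  have hzero (t : ℤ) : π {x | x t ∈ B} = π {x | x 0 ∈ B} := by
    induction t using Int.induction_on with
    | zero => rfl
    | succ i ih => rw [hsucc, ih]
    | pred i ih => rw [← ih, ← hsucc (-(i : ℤ) - 1), sub_add_cancel]
  rw [hzero s, hzero t]

lemma ae_eventually_apply_sub_le [IsProbabilityMeasure π] (hπ : MeasurePreserving shift π π)
    {φ : S → ℝ} (hφ : Measurable φ) (hφ0 : ∀ v, 0 ≤ φ v) {s : ℤ}
    (hint : Integrable (fun x => φ (x s)) π) (t : ℤ) :
    ∀ᵐ x ∂π, ∀ᶠ n : ℕ in atTop, φ (x (t - n)) ≤ n := by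
  have hsum : ∑' n : ℕ, π {x | φ (x (t - n)) ∈ Set.Ioi (n : ℝ)} ≠ ⊤ := by
    let _ : MeasureSpace (ℤ → S) := ⟨π⟩
    refine ne_of_lt ((tsum_congr fun n : ℕ => ?_).trans_lt
      (tsum_prob_mem_Ioi_lt_top hint fun x => hφ0 (x s)))
    exact measure_coordinate_eq hπ (hφ (measurableSet_Ioi (a := (n : ℝ)))) (t - n) s
  filter_upwards [ae_eventually_notMem hsum] with x hx
  exact hx.mono fun n hn => not_lt.1 hn

lemma ae_exists_frequently_abs_le {α : Type*} [MeasurableSpace α] {μ : Measure α} {f : α → α}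
    (hf : Conservative f μ) {W : α → ℝ} (hW : Measurable W) :
    ∀ᵐ x ∂μ, ∃ R : ℝ, ∃ᶠ n in atTop, |W (f^[n] x)| ≤ R := by
  have hrec : ∀ᵐ x ∂μ, ∀ k : ℕ, |W x| ≤ k → ∃ᶠ n in atTop, |W (f^[n] x)| ≤ k :=
    ae_all_iff.2 fun k => hf.ae_mem_imp_frequently_image_mem
      (measurableSet_le hW.abs measurable_const).nullMeasurableSet
  filter_upwards [hrec] with x hx
  exact ⟨_, hx _ (Nat.le_ceil _)⟩

theorem ae_exists_recurrent_window [IsFiniteMeasure π] (hπ : MeasurePreserving shift π π)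
    {V : ℤ → (ℤ → S) → ℝ} (hV : ∀ t, Measurable (V t))
    (hshift : ∀ t x, V t (shift x) = V (t + 1) x) (m : ℕ) :
    ∀ᵐ x ∂π, ∃ R : ℝ, ∀ T : ℤ, ∃ s < T, ∀ r, s ≤ r → r < s + m → |V r x| ≤ R := by
  have hsymm : MeasurePreserving (shiftEquiv S).symm π π :=
    MeasurePreserving.symm (shiftEquiv S) hπ
  have hback (n : ℕ) (r : ℤ) (x : ℤ → S) : V r ((shiftEquiv S).symm^[n] x) = V (r - n) x := by
    induction n generalizing x with
    | zero => simp
    | succ n ih =>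
      rw [Function.iterate_succ_apply, ih, show r - n = r - (n + 1 : ℕ) + 1 by push_cast; ring,
        ← hshift]
      exact congrArg _ ((shiftEquiv S).apply_symm_apply x)
  filter_upwards [ae_exists_frequently_abs_le hsymm.conservative
    (Finset.measurable_sum (Finset.range m) fun i _ => (hV i).abs)] with x ⟨R, hR⟩
  refine ⟨R, fun T => ?_⟩
  obtain ⟨n, hn, hn'⟩ := frequently_atTop.1 hR (T.natAbs + 1)
  refine ⟨-(n : ℤ), by omega, fun r h1 h2 => ?_⟩
  obtain ⟨i, hi⟩ := Int.eq_ofNat_of_zero_le (show 0 ≤ r + n by omega)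
  obtain rfl : r = i - n := by omega
  rw [← hback]
  exact (Finset.single_le_sum (f := fun i : ℕ => |V i ((shiftEquiv S).symm^[n] x)|)
    (fun i _ => abs_nonneg _) (Finset.mem_range.2 (show i < m by omega))).trans
    ((le_abs_self _).trans hn')

end Shift

/-! ### The latent process as a causal filter -/

section Latent

variable {E : Type*} [NormedAddCommGroup E]

/-- Covariate paths that grow more slowly than `ρ⁻¹ ^ n` into the past, so that the series
defining the latent process converges. -/
def Tame (ρ : ℝ) (x : ℤ → E) : Prop :=
  ∀ t : ℤ, Summable fun n : ℕ => ρ ^ n * ‖x (t - n)‖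

theorem ae_tame {ρ : ℝ} [MeasurableSpace E] [OpensMeasurableSpace E] {π : Measure (ℤ → E)}
    [IsProbabilityMeasure π] (hπ : MeasurePreserving shift π π) {s : ℤ}
    (hint : Integrable (fun x => Real.posLog ‖x s‖) π) (hρ0 : 0 < ρ) (hρ1 : ρ < 1) :
    ∀ᵐ x ∂π, Tame ρ x := by
  refine ae_all_iff.2 fun t => ?_
  set c := -Real.log ρ / 2 with hc
  have hc0 : 0 < c := by linarith [Real.log_neg hρ0 hρ1]
  have hrate : ρ * Real.exp c < 1 := by
    rw [← Real.exp_log hρ0, ← Real.exp_add, Real.exp_lt_one_iff]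
    linarith
  have hmeas : Measurable fun v : E => Real.posLog ‖v‖ / c :=
    ((measurable_const.max Real.measurable_log).comp measurable_norm).div_const c
  filter_upwards [ae_eventually_apply_sub_le hπ hmeas
    (fun v => div_nonneg Real.posLog_nonneg hc0.le) (hint.div_const c) t] with x hx
  refine Summable.of_norm_bounded_eventually_nat
    (summable_geometric_of_lt_one (by positivity) hrate) ?_
  filter_upwards [hx] with n hn
  rw [div_le_iff₀ hc0] at hn
  have hle : ‖x (t - n)‖ ≤ Real.exp c ^ n := by
    rcases (norm_nonneg (x (t - n))).eq_or_lt with h0 | h0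
    · rw [← h0]; positivity
    · rw [← Real.exp_log h0, ← Real.exp_nat_mul]
      exact Real.exp_le_exp.2 ((le_max_right _ _).trans hn)
  rw [Real.norm_of_nonneg (by positivity), mul_pow]
  exact mul_le_mul_of_nonneg_left hle (by positivity)

variable [InnerProductSpace ℝ E]

/-- The forcing term `∑_{k=1}^p α_k y_{t-k} + γ' x_t` of the latent recursion. -/
noncomputable def input (p : ℕ) (α : ℕ → ℝ) (γ : E) (t : ℤ) (y : ℤ → Fin 2) (x : ℤ → E) : ℝ :=
  ∑ k ∈ Finset.Icc 1 p, α k * ((y (t - (k : ℤ)) : ℕ) : ℝ) + inner ℝ γ (x t)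

/-- The latent process as a causal function of the responses and the covariates: the causal
solution of the latent recursion (with the junk value `0` when the series diverges). -/
noncomputable def latent (q p : ℕ) (β α : ℕ → ℝ) (γ : E) (t : ℤ) (y : ℤ → Fin 2) (x : ℤ → E) : ℝ :=
  ∑' n : ℕ, impulse q β n * input p α γ (t - n) y x

variable {q p : ℕ} {β α : ℕ → ℝ} {γ : E} {C ρ : ℝ} {x : ℤ → E} {y y' : ℤ → Fin 2}

lemma latent_shift (t : ℤ) (y : ℤ → Fin 2) (x : ℤ → E) :
    latent q p β α γ t (shift y) (shift x) = latent q p β α γ (t + 1) y x := by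
  have hk (n k : ℤ) : t - n - k + 1 = t + 1 - n - k := by ring
  have hn (n : ℤ) : t - n + 1 = t + 1 - n := by ring
  exact tsum_congr fun n => by simp only [input, shift, hk, hn]

lemma measurable_latent [MeasurableSpace E] [OpensMeasurableSpace E] [SecondCountableTopology E]
    {Ω : Type*} [MeasurableSpace Ω] {t : ℤ} {Y : ℤ → Ω → Fin 2} {X : ℤ → Ω → E}
    (hY : ∀ s < t, Measurable (Y s)) (hX : ∀ s, Measurable (X s)) :
    Measurable fun ω => latent q p β α γ t (fun s => Y s ω) (fun s => X s ω) := by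
  refine Measurable.tsum fun n => Measurable.const_mul (Measurable.add
    (Finset.measurable_sum _ fun k hk => Measurable.const_mul ?_ _) (hX _).const_inner) _
  have hlt : t - (n : ℤ) - k < t := by
    have := (Finset.mem_Icc.1 hk).1
    omega
  exact (Measurable.of_discrete (f := fun i : Fin 2 => ((i : ℕ) : ℝ))).comp (hY _ hlt)

lemma abs_input_le (t : ℤ) (y : ℤ → Fin 2) (x : ℤ → E) :
    |input p α γ t y x| ≤ ∑ k ∈ Finset.Icc 1 p, |α k| + ‖γ‖ * ‖x t‖ := by
  refine (abs_add_le _ _).trans (add_le_add ?_ (abs_real_inner_le_norm _ _))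
  refine (Finset.abs_sum_le_sum_abs _ _).trans (Finset.sum_le_sum fun k _ => ?_)
  rw [abs_mul, Nat.abs_cast]
  exact mul_le_of_le_one_right (abs_nonneg _) (val_apply_le_one _ _)

lemma input_sub_input (t : ℤ) (y y' : ℤ → Fin 2) (x : ℤ → E) :
    input p α γ t y x - input p α γ t y' x
      = ∑ k ∈ Finset.Icc 1 p,
        α k * (((y (t - (k : ℤ)) : ℕ) : ℝ) - ((y' (t - (k : ℤ)) : ℕ) : ℝ)) := by
  simp only [input, mul_sub, Finset.sum_sub_distrib]
  ring

lemma input_sub_input_eq_zero {t : ℤ} (h : ∀ r, t - p ≤ r → r < t → y r = y' r) (x : ℤ → E) :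
    input p α γ t y x - input p α γ t y' x = 0 := by
  rw [input_sub_input]
  refine Finset.sum_eq_zero fun k hk => ?_
  obtain ⟨h1, h2⟩ := Finset.mem_Icc.1 hk
  rw [h _ (by omega) (by omega), sub_self, mul_zero]

lemma abs_input_sub_input_le (t : ℤ) (y y' : ℤ → Fin 2) (x : ℤ → E) :
    |input p α γ t y x - input p α γ t y' x| ≤ ∑ k ∈ Finset.Icc 1 p, |α k| := by
  rw [input_sub_input]
  refine (Finset.abs_sum_le_sum_abs _ _).trans (Finset.sum_le_sum fun k _ => ?_)
  rw [abs_mul]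
  refine mul_le_of_le_one_right (abs_nonneg _) (abs_le.2 ⟨?_, ?_⟩)
  · linarith [val_apply_le_one (t - k) y', Nat.cast_nonneg (α := ℝ) (y (t - k))]
  · linarith [val_apply_le_one (t - k) y, Nat.cast_nonneg (α := ℝ) (y' (t - k))]

lemma Tame.summable_input (hρ0 : 0 < ρ) (hρ1 : ρ < 1) (hx : Tame ρ x) (y : ℤ → Fin 2) (t : ℤ) :
    Summable fun n : ℕ => ρ ^ n * |input p α γ (t - n) y x| := by
  refine Summable.of_nonneg_of_le (fun n => by positivity) (fun n => ?_)
    (((summable_geometric_of_lt_one hρ0.le hρ1).mul_right (∑ k ∈ Finset.Icc 1 p, |α k|)).add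
      ((hx t).mul_left ‖γ‖))
  calc ρ ^ n * |input p α γ (t - n) y x|
      ≤ ρ ^ n * (∑ k ∈ Finset.Icc 1 p, |α k| + ‖γ‖ * ‖x (t - n)‖) :=
        mul_le_mul_of_nonneg_left (abs_input_le _ _ _) (by positivity)
    _ = _ := by ring

lemma Tame.summable_latent (hx : Tame ρ x) (hM : HasPowerDecay q β C ρ) (y : ℤ → Fin 2) (t : ℤ) :
    Summable fun n : ℕ => impulse q β n * input p α γ (t - n) y x :=
  hM.summable_companion_pow_mul (u := fun t => input p α γ t y x)
    (hx.summable_input hM.rate_pos hM.rate_lt_one y t) 0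

theorem Tame.latent_eq (hx : Tame ρ x) (hM : HasPowerDecay q β C ρ) (y : ℤ → Fin 2) (t : ℤ) :
    latent q p β α γ t y x = ∑ j ∈ Finset.Icc 1 q, β j * latent q p β α γ (t - (j : ℤ)) y x
      + ∑ k ∈ Finset.Icc 1 p, α k * ((y (t - (k : ℤ)) : ℕ) : ℝ) + inner ℝ γ (x t) := by
  rw [add_assoc]
  exact hM.tsum_impulse_mul_eq (u := fun t => input p α γ t y x)
    (hx.summable_input hM.rate_pos hM.rate_lt_one y) t

/-- The constant in the modulus of continuity of the latent process. It goes with the rate `√ρ`: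
half of the decay `ρ ^ n` of the impulse response pays for the modulus of continuity, the other
half for the convergence of the series. -/
noncomputable def latentConst (p : ℕ) (α : ℕ → ℝ) (C ρ : ℝ) : ℝ :=
  C * (∑ k ∈ Finset.Icc 1 p, |α k|) / √ρ ^ p * (1 - √ρ)⁻¹

lemma HasPowerDecay.sqrt_lt_one (hM : HasPowerDecay q β C ρ) : √ρ < 1 := by
  simpa [Real.sqrt_lt' one_pos] using hM.rate_lt_one

lemma HasPowerDecay.latentConst_nonneg (hM : HasPowerDecay q β C ρ) : 0 ≤ latentConst p α C ρ :=
  mul_nonneg (div_nonneg (mul_nonneg hM.const_nonneg (Finset.sum_nonneg fun _ _ => abs_nonneg _))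
    (by positivity)) (inv_nonneg.2 (sub_nonneg.2 hM.sqrt_lt_one.le))

lemma HasPowerDecay.abs_impulse_mul_input_sub_le (hM : HasPowerDecay q β C ρ) {t : ℤ} {k : ℕ}
    (hy : ∀ r, t - k ≤ r → r < t → y r = y' r) (x : ℤ → E) (n : ℕ) :
    |impulse q β n * (input p α γ (t - n) y x - input p α γ (t - n) y' x)|
      ≤ C * (∑ k ∈ Finset.Icc 1 p, |α k|) / √ρ ^ p * √ρ ^ k * √ρ ^ n := by
  have hC := hM.const_nonneg
  have hr := Real.sqrt_pos.2 hM.rate_pos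
  rcases le_or_gt (n + p) k with hnk | hnk
  · rw [input_sub_input_eq_zero fun r h1 h2 => hy r (by omega) (by omega), mul_zero, abs_zero]
    positivity
  · have hpow : √ρ ^ n ≤ √ρ ^ k / √ρ ^ p := by
      rw [le_div_iff₀ (by positivity), ← pow_add]
      exact pow_le_pow_of_le_one hr.le hM.sqrt_lt_one.le hnk.le
    have hsq : ρ ^ n = √ρ ^ n * √ρ ^ n := by rw [← mul_pow, Real.mul_self_sqrt hM.rate_pos.le]
    rw [abs_mul]
    calc |impulse q β n| * |input p α γ (t - n) y x - input p α γ (t - n) y' x|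
        ≤ C * ρ ^ n * ∑ k ∈ Finset.Icc 1 p, |α k| :=
          mul_le_mul (hM.abs_le n 0 0) (abs_input_sub_input_le _ _ _ _) (abs_nonneg _)
            (mul_nonneg hC (pow_nonneg hM.rate_pos.le n))
      _ = C * (∑ k ∈ Finset.Icc 1 p, |α k|) * √ρ ^ n * √ρ ^ n := by rw [hsq]; ring
      _ ≤ C * (∑ k ∈ Finset.Icc 1 p, |α k|) * (√ρ ^ k / √ρ ^ p) * √ρ ^ n := by gcongr
      _ = _ := by ring

theorem Tame.oscLE_latent (hx : Tame ρ x) (hM : HasPowerDecay q β C ρ) (t : ℤ) (k : ℕ) :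
    OscLE (fun y => latent q p β α γ t y x) t k (latentConst p α C ρ * √ρ ^ k) := by
  intro y y' hy
  have hbound := tsum_of_norm_bounded
    (f := fun n : ℕ => impulse q β n * (input p α γ (t - n) y x - input p α γ (t - n) y' x))
    ((hasSum_geometric_of_lt_one (Real.sqrt_nonneg ρ) hM.sqrt_lt_one).mul_left
      (C * (∑ k ∈ Finset.Icc 1 p, |α k|) / √ρ ^ p * √ρ ^ k))
    (hM.abs_impulse_mul_input_sub_le (p := p) (α := α) (γ := γ) hy x)
  simp only [mul_sub] at hbound
  rw [(hx.summable_latent hM y t).tsum_sub (hx.summable_latent hM y' t)] at hbound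
  exact hbound.trans (le_of_eq (by rw [latentConst]; ring))

end Latent

section Forgets

/-- The influence of the remote past on the averages of functions of a recent past vanishes. -/
def Forgets (g : ℤ → (ℤ → Fin 2) → ℝ) : Prop :=
  ∀ (N : ℤ) (f : (ℤ → Fin 2) → ℝ), (∀ ε > 0, ∃ K, OscLE f N K ε) → ∀ y y' : ℤ → Fin 2,
    Tendsto (fun n => backAverage g N n f y - backAverage g N n f y') atTop (𝓝 0)

variable {g : ℤ → (ℤ → Fin 2) → ℝ} {f : (ℤ → Fin 2) → ℝ}

theorem IsTransition.forgets {b : ℕ → ℝ} (hg : IsTransition g b) (hb : Tendsto b atTop (𝓝 0))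
    {m : ℕ} (hm : ∀ j, ∑ i ∈ Finset.range j, b (m + i) ≤ 1 / 2)
    (hwin : ∃ δ > 0, ∀ T : ℤ, ∃ s < T, ∀ r, s ≤ r → r < s + m → ∀ y, δ ≤ g r y) :
    Forgets g := by
  intro N f hf y y'
  obtain ⟨c, hc⟩ :=
    isCompact_univ.exists_bound_of_continuousOn (continuous_of_oscLE hf).continuousOn
  have hw : OscLE f N 0 (c + c) := fun y y' _ =>
    (abs_sub _ _).trans (add_le_add (hc y trivial) (hc y' trivial))
  refine Metric.tendsto_atTop.2 fun ε hε => ?_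
  obtain ⟨n₀, hn₀⟩ :=
    exists_forall_ge_oscLE_backAverage hg hb hm hwin hw hf (ε / 2) (half_pos hε)
  refine ⟨n₀, fun n hn => ?_⟩
  rw [Real.dist_eq, sub_zero]
  exact (hn₀ n hn y y' fun r h1 h2 => by omega).trans_lt (half_lt_self hε)

lemma abs_backAverage_le (h0 : ∀ t y, 0 ≤ g t y) (h1 : ∀ t y, g t y ≤ 1) (N : ℤ) {c : ℝ}
    (hf : ∀ y, |f y| ≤ c) (n : ℕ) (y : ℤ → Fin 2) : |backAverage g N n f y| ≤ c := by
  induction n generalizing y with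
  | zero => exact hf y
  | succ n ih =>
    set t := N - ((n + 1 : ℕ) : ℤ)
    obtain ⟨hl₁, hu₁⟩ := abs_le.1 (ih (Function.update y t 1))
    obtain ⟨hl₀, hu₀⟩ := abs_le.1 (ih (Function.update y t 0))
    exact abs_le.2 ⟨by simp only [backAverage, averageAt]; nlinarith [h0 t y, h1 t y],
      by simp only [backAverage, averageAt]; nlinarith [h0 t y, h1 t y]⟩

lemma integrable_of_abs_le {α : Type*} [MeasurableSpace α] {P : Measure α} [IsFiniteMeasure P]
    {f : α → ℝ} (hf : Measurable f) {c : ℝ} (hc : ∀ a, |f a| ≤ c) : Integrable f P :=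
  Integrable.of_bound hf.aestronglyMeasurable c (Eventually.of_forall hc)

theorem Forgets.tendsto_backAverage (hforget : Forgets g) (h0 : ∀ t y, 0 ≤ g t y)
    (h1 : ∀ t y, g t y ≤ 1) (hc : ∀ t, Continuous (g t)) (hg : ∀ t, DependsOn (g t) (Set.Iio t))
    {κ : Measure (ℤ → Fin 2)} [IsProbabilityMeasure κ] (hκ : IsChainLaw g κ) {N : ℤ}
    (hf : ∀ ε > 0, ∃ K, OscLE f N K ε) (y : ℤ → Fin 2) :
    Tendsto (fun n => backAverage g N n f y) atTop (𝓝 (∫ y, f y ∂κ)) := by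
  have hcont := continuous_of_oscLE hf
  obtain ⟨c, hfc⟩ := isCompact_univ.exists_bound_of_continuousOn hcont.continuousOn
  have hmeas (n : ℕ) := (continuous_backAverage hc N hcont n).measurable
  have hbound (n : ℕ) (y) : |backAverage g N n f y| ≤ c :=
    abs_backAverage_le h0 h1 N (fun y => hfc y trivial) n y
  have hlim : Tendsto (fun n => ∫ z, (backAverage g N n f y - backAverage g N n f z) ∂κ) atTop
      (𝓝 (∫ _, (0 : ℝ) ∂κ)) :=
    tendsto_integral_of_dominated_convergence (fun _ => c + c)
      (fun n => ((hmeas n).const_sub _).aestronglyMeasurable) (integrable_const _)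
      (fun n => Eventually.of_forall fun z =>
        (abs_sub _ _).trans (add_le_add (hbound n y) (hbound n z)))
      (Eventually.of_forall fun z => hforget N f hf y z)
  have heq (n : ℕ) : ∫ z, (backAverage g N n f y - backAverage g N n f z) ∂κ
      = backAverage g N n f y - ∫ z, f z ∂κ := by
    rw [integral_sub (integrable_const _) (integrable_of_abs_le (hmeas n) (hbound n)),
      ← hκ.integral_eq_integral_backAverage hc hg hcont (dependsOn_of_oscLE hf)]
    simp
  simp only [heq, integral_zero] at hlim
  simpa using hlim.add_const (∫ z, f z ∂κ)

end Forgets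

/-! ### Chains in a random environment -/

section Environment

variable {𝒳 : Type*}

/-- The responses before time `t` together with the environment. -/
def history (t : ℤ) (z : (ℤ → Fin 2) × 𝒳) : (ℤ → Fin 2) × 𝒳 := (trunc t z.1, z.2)

/-- The deviation of the response at time `t` from its transition probability. -/
def innovation (G : ℤ → (ℤ → Fin 2) → 𝒳 → ℝ) (t : ℤ) (z : (ℤ → Fin 2) × 𝒳) : ℝ :=
  ((z.1 t : ℕ) : ℝ) - G t z.1 z.2

/-- The average `backAverage` of `f` in the environment `z.2`, evaluated at `z.1`. -/
def envBackAverage (G : ℤ → (ℤ → Fin 2) → 𝒳 → ℝ) (N : ℤ) (n : ℕ)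
    (f : (ℤ → Fin 2) × 𝒳 → ℝ) (z : (ℤ → Fin 2) × 𝒳) : ℝ :=
  backAverage (fun t y => G t y z.2) N n (fun y => f (y, z.2)) z.1

variable {G : ℤ → (ℤ → Fin 2) → 𝒳 → ℝ} {f : (ℤ → Fin 2) × 𝒳 → ℝ} {c : ℝ} {N t : ℤ}

lemma history_history_of_le {s : ℤ} (h : s ≤ t) (z : (ℤ → Fin 2) × 𝒳) :
    history s (history t z) = history s z :=
  Prod.ext (dependsOn_trunc s fun _ hr => if_pos (lt_of_lt_of_le hr h)) rfl

-- A function of the history up to time `t` is affine in the response at time `t`.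
lemma averageAt_eq_sub_mul_innovation
    (hdep : ∀ x, DependsOn (fun y => f (y, x)) (Set.Iio (t + 1))) (z : (ℤ → Fin 2) × 𝒳) :
    averageAt (fun y => G t y z.2) t (fun y => f (y, z.2)) z.1
      = f z - (f (Function.update (history t z).1 t 1, (history t z).2)
        - f (Function.update (history t z).1 t 0, (history t z).2)) * innovation G t z := by
  have hhist (i : Fin 2) : f (Function.update (history t z).1 t i, (history t z).2)
      = f (Function.update z.1 t i, z.2) :=
    apply_trunc_of_dependsOn (dependsOn_comp_update (hdep z.2) i) z.1
  have hz : f z = f (Function.update z.1 t (z.1 t), z.2) := by rw [Function.update_eq_self]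
  rw [hhist, hhist, innovation, averageAt]
  rcases (by omega : z.1 t = 0 ∨ z.1 t = 1) with hzt | hzt <;> rw [hz, hzt] <;> simp <;> ring

variable [MeasurableSpace 𝒳] {Q Q' : Measure ((ℤ → Fin 2) × 𝒳)}

/-- A measurable family of transition probabilities in a random environment: `G t y x` is the
probability of the value `1` at time `t` after the history `y` in the environment `x`. -/
structure IsEnvironmentTransition (G : ℤ → (ℤ → Fin 2) → 𝒳 → ℝ) : Prop where
  measurable : ∀ t, Measurable fun z : (ℤ → Fin 2) × 𝒳 => G t z.1 z.2
  nonneg : ∀ t y x, 0 ≤ G t y x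
  le_one : ∀ t y x, G t y x ≤ 1
  dependsOn : ∀ t x, DependsOn (fun y => G t y x) (Set.Iio t)

/-- Under `Q`, the conditional probability of `y_t = 1` given the past of `y` and the whole
environment `x` is `G t y x`. -/
def IsCompatible (G : ℤ → (ℤ → Fin 2) → 𝒳 → ℝ) (Q : Measure ((ℤ → Fin 2) × 𝒳)) : Prop :=
  ∀ (t : ℤ) (h : (ℤ → Fin 2) × 𝒳 → ℝ) (c : ℝ), Measurable h → (∀ z, |h z| ≤ c) →
    ∫ z, h (history t z) * innovation G t z ∂Q = 0

lemma measurable_history (t : ℤ) : Measurable (history t : (ℤ → Fin 2) × 𝒳 → _) :=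
  ((measurable_trunc t).comp measurable_fst).prodMk measurable_snd

lemma measurable_prodMap_update (t : ℤ) (i : Fin 2) :
    Measurable fun z : (ℤ → Fin 2) × 𝒳 => (Function.update z.1 t i, z.2) :=
  ((continuous_id.update t continuous_const).measurable.comp measurable_fst).prodMk measurable_snd

namespace IsEnvironmentTransition

lemma measurable_innovation (hG : IsEnvironmentTransition G) (t : ℤ) :
    Measurable (innovation G t) :=
  ((continuous_val_apply t).measurable.comp measurable_fst).sub (hG.measurable t)

lemma abs_mul_innovation_le (hG : IsEnvironmentTransition G) (t : ℤ) {a : ℝ} (ha : |a| ≤ c)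
    (z : (ℤ → Fin 2) × 𝒳) : |a * innovation G t z| ≤ c := by
  have hle : |innovation G t z| ≤ 1 := abs_sub_le_of_le_of_le (Nat.cast_nonneg _)
    (val_apply_le_one t z.1) (hG.nonneg t z.1 z.2) (hG.le_one t z.1 z.2) |>.trans (by norm_num)
  rw [abs_mul]
  exact (mul_le_of_le_one_right (abs_nonneg a) hle).trans ha

lemma integrable_comp_history_mul_innovation [IsFiniteMeasure Q]
    (hG : IsEnvironmentTransition G) (t : ℤ) (hf : Measurable f) (hc : ∀ z, |f z| ≤ c) :
    Integrable (fun z => f (history t z) * innovation G t z) Q :=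
  integrable_of_abs_le ((hf.comp (measurable_history t)).mul (hG.measurable_innovation t))
    fun z => hG.abs_mul_innovation_le t (hc _) z

lemma measurable_envBackAverage (hG : IsEnvironmentTransition G) (hf : Measurable f) (N : ℤ)
    (n : ℕ) : Measurable (envBackAverage G N n f) := by
  induction n with
  | zero => exact hf
  | succ n ih =>
    exact ((hG.measurable _).mul (ih.comp (measurable_prodMap_update _ 1))).add
      ((measurable_const.sub (hG.measurable _)).mul (ih.comp (measurable_prodMap_update _ 0)))

lemma abs_envBackAverage_le (hG : IsEnvironmentTransition G) (hc : ∀ z, |f z| ≤ c) (N : ℤ)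
    (n : ℕ) (z : (ℤ → Fin 2) × 𝒳) : |envBackAverage G N n f z| ≤ c :=
  abs_backAverage_le (fun t y => hG.nonneg t y z.2) (fun t y => hG.le_one t y z.2) N
    (fun y => hc (y, z.2)) n z.1

end IsEnvironmentTransition

namespace IsCompatible

lemma integral_averageAt [IsFiniteMeasure Q] (hQ : IsCompatible G Q)
    (hG : IsEnvironmentTransition G) (hf : Measurable f) (hc : ∀ z, |f z| ≤ c)
    (hdep : ∀ x, DependsOn (fun y => f (y, x)) (Set.Iio (t + 1))) :
    ∫ z, averageAt (fun y => G t y z.2) t (fun y => f (y, z.2)) z.1 ∂Q = ∫ z, f z ∂Q := by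
  set d : (ℤ → Fin 2) × 𝒳 → ℝ := fun z =>
    f (Function.update z.1 t 1, z.2) - f (Function.update z.1 t 0, z.2)
  have hd : Measurable d := (hf.comp (measurable_prodMap_update t 1)).sub
    (hf.comp (measurable_prodMap_update t 0))
  have hdc (z) : |d z| ≤ c + c := (abs_sub _ _).trans (add_le_add (hc _) (hc _))
  calc ∫ z, averageAt (fun y => G t y z.2) t (fun y => f (y, z.2)) z.1 ∂Q
      = ∫ z, (f z - d (history t z) * innovation G t z) ∂Q :=
        integral_congr_ae (.of_forall fun z => averageAt_eq_sub_mul_innovation hdep z)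
    _ = ∫ z, f z ∂Q := by
        rw [integral_sub (integrable_of_abs_le hf hc)
          (hG.integrable_comp_history_mul_innovation t hd hdc), hQ t d _ hd hdc, sub_zero]

lemma integral_envBackAverage [IsFiniteMeasure Q] (hQ : IsCompatible G Q)
    (hG : IsEnvironmentTransition G) (hf : Measurable f) (hc : ∀ z, |f z| ≤ c)
    (hdep : ∀ x, DependsOn (fun y => f (y, x)) (Set.Iio N)) (n : ℕ) :
    ∫ z, envBackAverage G N n f z ∂Q = ∫ z, f z ∂Q := by
  induction n with
  | zero => rfl
  | succ n ih =>
    rw [← ih]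
    exact hQ.integral_averageAt hG (hG.measurable_envBackAverage hf N n)
      (hG.abs_envBackAverage_le hc N n) fun x =>
        dependsOn_Iio_mono (dependsOn_backAverage (hG.dependsOn · x) (hdep x) n)
          (by push_cast; omega)

theorem tendsto_integral_envBackAverage [IsFiniteMeasure Q] (hQ : IsCompatible G Q)
    (hG : IsEnvironmentTransition G)
    (hforget : ∀ᵐ x ∂(Q.map Prod.snd), Forgets fun t y => G t y x) (hf : Measurable f)
    (hc : ∀ z, |f z| ≤ c) (hosc : ∀ x, ∀ ε > 0, ∃ K, OscLE (fun y => f (y, x)) N K ε)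
    (y : ℤ → Fin 2) :
    Tendsto (fun n => ∫ x, envBackAverage G N n f (y, x) ∂(Q.map Prod.snd)) atTop
      (𝓝 (∫ z, f z ∂Q)) := by
  have hmeas (n : ℕ) := hG.measurable_envBackAverage hf N n
  have hmeasy (n : ℕ) : Measurable fun x => envBackAverage G N n f (y, x) :=
    (hmeas n).comp measurable_prodMk_left
  have hbound (n : ℕ) (z) : |envBackAverage G N n f z| ≤ c := hG.abs_envBackAverage_le hc N n z
  have hlim : Tendsto
      (fun n => ∫ z, (envBackAverage G N n f (y, z.2) - envBackAverage G N n f z) ∂Q) atTop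
      (𝓝 (∫ _, (0 : ℝ) ∂Q)) := by
    refine tendsto_integral_of_dominated_convergence (fun _ => c + c)
      (fun n => (((hmeasy n).comp measurable_snd).sub (hmeas n)).aestronglyMeasurable)
      (integrable_const _) (fun n => Eventually.of_forall fun z =>
        (abs_sub _ _).trans (add_le_add (hbound n _) (hbound n z))) ?_
    filter_upwards [ae_of_ae_map measurable_snd.aemeasurable hforget] with z hz
    exact hz N _ (hosc z.2) y z.1
  have heq (n : ℕ) : ∫ z, (envBackAverage G N n f (y, z.2) - envBackAverage G N n f z) ∂Q
      = ∫ x, envBackAverage G N n f (y, x) ∂(Q.map Prod.snd) - ∫ z, f z ∂Q := by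
    have hint : Integrable (fun z => envBackAverage G N n f (y, z.2)) Q :=
      integrable_of_abs_le ((hmeasy n).comp measurable_snd) fun z => hbound n _
    rw [integral_sub hint (integrable_of_abs_le (hmeas n) (hbound n)),
      hQ.integral_envBackAverage hG hf hc (fun x => dependsOn_of_oscLE (hosc x)),
      integral_map measurable_snd.aemeasurable (hmeasy n).aestronglyMeasurable]
  simp only [heq, integral_zero] at hlim
  simpa using hlim.add_const (∫ z, f z ∂Q)

theorem unique [IsFiniteMeasure Q] [IsFiniteMeasure Q'] (hQ : IsCompatible G Q)
    (hQ' : IsCompatible G Q') (hG : IsEnvironmentTransition G)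
    (hmarg : Q.map Prod.snd = Q'.map Prod.snd)
    (hforget : ∀ᵐ x ∂(Q.map Prod.snd), Forgets fun t y => G t y x) : Q = Q' := by
  have huniv : Q Set.univ = Q' Set.univ := by
    simpa [Measure.map_apply measurable_snd] using congrArg (· Set.univ) hmarg
  refine ext_of_generate_finite
    (Set.image2 (· ×ˢ ·) (measurableCylinders fun _ : ℤ => Fin 2) {B : Set 𝒳 | MeasurableSet B})
    (generateFrom_eq_prod generateFrom_measurableCylinders
      MeasurableSpace.generateFrom_measurableSet
      ⟨fun _ => Set.univ, fun _ => univ_mem_measurableCylinders _, Set.iUnion_const _⟩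
      isCountablySpanning_measurableSet).symm
    (isPiSystem_measurableCylinders.prod MeasurableSpace.isPiSystem_measurableSet) ?_ huniv
  rintro _ ⟨C, hC, B, hB : MeasurableSet B, rfl⟩
  obtain ⟨N, K, hK⟩ := exists_oscLE_indicator_cylinder hC
  have hmeas : MeasurableSet (C ×ˢ B) := (MeasurableSet.of_mem_measurableCylinders hC).prod hB
  have hf : Measurable ((C ×ˢ B).indicator (1 : (ℤ → Fin 2) × 𝒳 → ℝ)) :=
    measurable_one.indicator hmeas
  have hc (z) : |(C ×ˢ B).indicator (1 : (ℤ → Fin 2) × 𝒳 → ℝ) z| ≤ 1 := by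
    by_cases hz : z ∈ C ×ˢ B <;> simp only [Set.indicator, hz] <;> simp
  have hosc (x : 𝒳) (ε : ℝ) (hε : ε > 0) :
      ∃ K, OscLE (fun y => (C ×ˢ B).indicator (1 : (ℤ → Fin 2) × 𝒳 → ℝ) (y, x)) N K ε := by
    refine ⟨K, fun y y' hy => le_of_eq_of_le ?_ hε.le⟩
    have hCy : C.indicator (1 : (ℤ → Fin 2) → ℝ) y = C.indicator 1 y' :=
      sub_eq_zero.1 (abs_nonpos_iff.1 (hK y y' hy))
    have hprod (y) : (C ×ˢ B).indicator (1 : (ℤ → Fin 2) × 𝒳 → ℝ) (y, x)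
      = C.indicator 1 y * B.indicator 1 x := Set.indicator_prod_one
    simp only [hprod, hCy, sub_self, abs_zero]
  have heq := tendsto_nhds_unique (hQ.tendsto_integral_envBackAverage hG hforget hf hc hosc 0)
    (hmarg ▸ hQ'.tendsto_integral_envBackAverage hG (hmarg ▸ hforget) hf hc hosc 0)
  rw [integral_indicator_one hmeas, integral_indicator_one hmeas] at heq
  exact (measureReal_eq_measureReal_iff).1 heq

end IsCompatible

end Environment

section Existence

variable {𝒳 𝒲 : Type*} [MeasurableSpace 𝒳] [MeasurableSpace 𝒲]
  {G : ℤ → (ℤ → Fin 2) → 𝒳 → ℝ} {X : 𝒲 → 𝒳}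

lemma IsEnvironmentTransition.comp (hG : IsEnvironmentTransition G) (hX : Measurable X) :
    IsEnvironmentTransition fun t y w => G t y (X w) where
  measurable t := (hG.measurable t).comp (measurable_id.prodMap hX)
  nonneg t y w := hG.nonneg t y (X w)
  le_one t y w := hG.le_one t y (X w)
  dependsOn t w := hG.dependsOn t (X w)

lemma IsCompatible.map_prodMap {Q : Measure ((ℤ → Fin 2) × 𝒲)} [IsFiniteMeasure Q]
    (hQ : IsCompatible (fun t y w => G t y (X w)) Q) (hG : IsEnvironmentTransition G)
    (hX : Measurable X) : IsCompatible G (Q.map (Prod.map id X)) := by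
  intro t h c hh hc
  have hmap : Measurable (Prod.map id X : (ℤ → Fin 2) × 𝒲 → _) := measurable_id.prodMap hX
  rw [integral_map hmap.aemeasurable
    (hG.integrable_comp_history_mul_innovation t hh hc).aestronglyMeasurable]
  exact hQ t (h ∘ Prod.map id X) c (hh.comp hmap) fun z => hc _

theorem exists_kernel_isChainLaw (hG : IsEnvironmentTransition G)
    (hcont : ∀ x t, Continuous fun y => G t y x) (hforget : ∀ x, Forgets fun t y => G t y x) :
    ∃ κ : Kernel 𝒳 (ℤ → Fin 2),
      IsMarkovKernel κ ∧ ∀ x, IsChainLaw (fun t y => G t y x) (κ x) := by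
  choose κ hκp hκ using fun x => exists_isChainLaw (g := fun t y => G t y x)
    (fun t y => hG.nonneg t y x) (fun t y => hG.le_one t y x) (hcont x) (hG.dependsOn · x)
  have hmeas : Measurable κ := by
    refine Measurable.measure_of_isPiSystem_of_isProbabilityMeasure
      generateFrom_measurableCylinders.symm isPiSystem_measurableCylinders fun C hC => ?_
    obtain ⟨N, K, hK⟩ := exists_oscLE_indicator_cylinder hC
    have hCm : MeasurableSet C := MeasurableSet.of_mem_measurableCylinders hC
    have hlim (x : 𝒳) : Tendsto
        (fun n => envBackAverage G N n (fun z => C.indicator 1 z.1) ((0 : ℤ → Fin 2), x)) atTop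
        (𝓝 ((κ x).real C)) := by
      rw [← integral_indicator_one hCm]
      exact (hforget x).tendsto_backAverage (fun t y => hG.nonneg t y x)
        (fun t y => hG.le_one t y x) (hcont x) (hG.dependsOn · x) (hκ x)
        (fun ε hε => ⟨K, fun y y' hy => (hK y y' hy).trans hε.le⟩) 0
    have hreal : Measurable fun x => (κ x).real C :=
      measurable_of_tendsto_metrizable (fun n => (hG.measurable_envBackAverage
        ((measurable_one.indicator hCm).comp measurable_fst) N n).comp measurable_prodMk_left)
        (tendsto_pi_nhds.2 hlim)
    have hofReal : (fun x => ENNReal.ofReal ((κ x).real C)) = fun x => κ x C :=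
      funext fun x => ofReal_measureReal
    exact hofReal ▸ hreal.ennreal_ofReal
  exact ⟨⟨κ, hmeas⟩, ⟨hκp⟩, hκ⟩

lemma isCompatible_compProd {π : Measure 𝒳} [IsFiniteMeasure π] {κ : Kernel 𝒳 (ℤ → Fin 2)}
    [IsMarkovKernel κ] (hG : IsEnvironmentTransition G)
    (hcont : ∀ x t, Continuous fun y => G t y x)
    (hκ : ∀ x, IsChainLaw (fun t y => G t y x) (κ x)) :
    IsCompatible G ((π ⊗ₘ κ).map Prod.swap) := by
  intro t h c hh hc
  have hint := hG.integrable_comp_history_mul_innovation (Q := (π ⊗ₘ κ).map Prod.swap) t hh hc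
  rw [integral_map measurable_swap.aemeasurable hint.aestronglyMeasurable,
    Measure.integral_compProd (f := fun z => h (history t z.swap) * innovation G t z.swap)
      ((integrable_map_measure hint.aestronglyMeasurable measurable_swap.aemeasurable).1 hint)]
  refine integral_eq_zero_of_ae (.of_forall fun x => ?_)
  have hhx : Measurable fun y => h (y, x) := hh.comp measurable_prodMk_right
  have hbound {k : (ℤ → Fin 2) → ℝ} (hk : Measurable k) (hk0 : ∀ y, 0 ≤ k y)
      (hk1 : ∀ y, k y ≤ 1) : Integrable (fun y => h (trunc t y, x) * k y) (κ x) := by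
    refine integrable_of_abs_le ((hhx.comp (measurable_trunc t)).mul hk) (c := c) fun y => ?_
    rw [abs_mul, abs_of_nonneg (hk0 y)]
    exact (mul_le_of_le_one_right (abs_nonneg _) (hk1 y)).trans (hc _)
  have heq := (hκ x).integral_comp_trunc_mul (fun t y => hG.nonneg t y x)
    (fun t y => hG.le_one t y x) (hcont x) t hhx
  calc ∫ y, h (history t (y, x)) * innovation G t (y, x) ∂(κ x)
      = ∫ y, (h (trunc t y, x) * ((y t : ℕ) : ℝ) - h (trunc t y, x) * G t y x) ∂(κ x) :=
        integral_congr_ae (.of_forall fun y => mul_sub _ _ _)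
    _ = 0 := by
      rw [integral_sub (hbound (continuous_val_apply t).measurable (fun y => Nat.cast_nonneg _)
        (val_apply_le_one t)) (hbound (hcont x t).measurable (fun y => hG.nonneg t y x)
        fun y => hG.le_one t y x), heq, sub_self]

theorem exists_isCompatible (hG : IsEnvironmentTransition G) (π : Measure 𝒳)
    [IsProbabilityMeasure π] (hcont : ∀ᵐ x ∂π, ∀ t, Continuous fun y => G t y x)
    (hforget : ∀ᵐ x ∂π, Forgets fun t y => G t y x) :
    ∃ Q : Measure ((ℤ → Fin 2) × 𝒳),
      IsProbabilityMeasure Q ∧ Q.map Prod.snd = π ∧ IsCompatible G Q := by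
  obtain ⟨D, hsub, hD, hDπ⟩ := exists_measurable_superset_of_null (hcont.and hforget)
  have hgood (x : (Dᶜ : Set 𝒳)) := not_not.1 (mt (@hsub x) x.2)
  have hDae : ∀ᵐ x ∂π, x ∈ Dᶜ := measure_eq_zero_iff_ae_notMem.1 hDπ
  have hval : Measurable ((↑) : (Dᶜ : Set 𝒳) → 𝒳) := measurable_subtype_coe
  have hmap : (π.comap ((↑) : (Dᶜ : Set 𝒳) → 𝒳)).map (↑) = π := by
    rw [map_comap_subtype_coe hD.compl, Measure.restrict_eq_self_of_ae_mem hDae]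
  have hprob : IsProbabilityMeasure (π.comap ((↑) : (Dᶜ : Set 𝒳) → 𝒳)) :=
    ⟨by rw [← Set.preimage_univ (f := ((↑) : (Dᶜ : Set 𝒳) → 𝒳)),
      ← Measure.map_apply hval .univ, hmap, measure_univ]⟩
  have hGD := hG.comp hval
  obtain ⟨κ, hκp, hκ⟩ := exists_kernel_isChainLaw hGD (fun x => (hgood x).1) fun x => (hgood x).2
  set Q := ((π.comap ((↑) : (Dᶜ : Set 𝒳) → 𝒳)) ⊗ₘ κ).map Prod.swap
  have hQ : IsProbabilityMeasure Q :=
    Measure.isProbabilityMeasure_map measurable_swap.aemeasurable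
  have hpair : Measurable (Prod.map id (↑) : (ℤ → Fin 2) × (Dᶜ : Set 𝒳) → (ℤ → Fin 2) × 𝒳) :=
    measurable_id.prodMap hval
  refine ⟨Q.map (Prod.map id (↑)), Measure.isProbabilityMeasure_map hpair.aemeasurable, ?_,
    (isCompatible_compProd hGD (fun x => (hgood x).1) hκ).map_prodMap hG hval⟩
  calc (Q.map (Prod.map id (↑))).map Prod.snd
      = (((π.comap ((↑) : (Dᶜ : Set 𝒳) → 𝒳)) ⊗ₘ κ).map Prod.fst).map Subtype.val := by
        rw [Measure.map_map measurable_snd hpair, Measure.map_map (measurable_snd.comp hpair)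
          measurable_swap, Measure.map_map hval measurable_fst]
        rfl
    _ = π := (congrArg (Measure.map Subtype.val) (Measure.fst_compProd _ κ)).trans hmap

end Existence

section Ergodicity

section PastEvents

variable {𝒳 : Type*} [MeasurableSpace 𝒳]

variable (𝒳) in
/-- The events that depend only on the environment and on the responses up to some time. -/
def pastEvents : Set (Set ((ℤ → Fin 2) × 𝒳)) :=
  {B | ∃ (N : ℕ) (D : Set _), MeasurableSet D ∧ B = history N ⁻¹' D}

lemma isSetAlgebra_pastEvents : IsSetAlgebra (pastEvents 𝒳) where
  empty_mem := ⟨0, ∅, MeasurableSet.empty, rfl⟩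
  compl_mem := by
    rintro _ ⟨N, D, hD, rfl⟩
    exact ⟨N, Dᶜ, hD.compl, rfl⟩
  union_mem := by
    rintro _ _ ⟨N, D, hD, rfl⟩ ⟨N', D', hD', rfl⟩
    refine ⟨max N N', history N ⁻¹' D ∪ history N' ⁻¹' D',
      (measurable_history _ hD).union (measurable_history _ hD'), ?_⟩
    ext z
    simp only [Set.mem_union, Set.mem_preimage]
    rw [history_history_of_le (by exact_mod_cast le_max_left N N'),
      history_history_of_le (by exact_mod_cast le_max_right N N')]

lemma generateFrom_pastEvents :
    MeasurableSpace.generateFrom (pastEvents 𝒳) = Prod.instMeasurableSpace := by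
  refine le_antisymm (MeasurableSpace.generateFrom_le ?_) (sup_le ?_ ?_)
  · rintro _ ⟨N, D, hD, rfl⟩
    exact measurable_history _ hD
  · rw [← measurable_iff_comap_le]
    refine @measurable_pi_lambda _ _ _ (_) _ _ fun r A hA => ?_
    refine MeasurableSpace.measurableSet_generateFrom
      ⟨r.natAbs + 1, _, (measurable_pi_apply r).comp measurable_fst hA, ?_⟩
    ext z
    have happly : (history (r.natAbs + 1 : ℕ) z).1 r = z.1 r :=
      if_pos (show r < (r.natAbs + 1 : ℕ) by omega)
    simp only [Set.mem_preimage, Function.comp, happly]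
  · rintro _ ⟨B, hB, rfl⟩
    exact MeasurableSpace.measurableSet_generateFrom ⟨0, _, measurable_snd hB, rfl⟩

end PastEvents

lemma abs_setIntegral_sub_setIntegral_le {α : Type*} [MeasurableSpace α] {μ : Measure α}
    [IsFiniteMeasure μ] {k : α → ℝ} (hk : Measurable k) {c : ℝ} (hc : ∀ a, |k a| ≤ c)
    {s B : Set α} (hs : MeasurableSet s) (hB : MeasurableSet B) :
    |∫ a in s, k a ∂μ - ∫ a in B, k a ∂μ| ≤ c * μ.real (symmDiff s B) := by
  have hind {A : Set α} (hA : MeasurableSet A) : Integrable (A.indicator k) μ :=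
    (integrable_of_abs_le hk hc).indicator hA
  calc |∫ a in s, k a ∂μ - ∫ a in B, k a ∂μ|
      = |∫ a, (s.indicator k a - B.indicator k a) ∂μ| := by
        rw [integral_sub (hind hs) (hind hB), integral_indicator hs, integral_indicator hB]
    _ ≤ ∫ a, |s.indicator k a - B.indicator k a| ∂μ := abs_integral_le_integral_abs
    _ ≤ ∫ a, (symmDiff s B).indicator (fun _ => c) a ∂μ := by
        refine integral_mono ((hind hs).sub (hind hB)).abs
          ((integrable_const _).indicator (hs.symmDiff hB)) fun a => ?_
        by_cases h1 : a ∈ s <;> by_cases h2 : a ∈ B <;> simp [h1, h2, Set.mem_symmDiff, hc a]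
    _ = c * μ.real (symmDiff s B) := by
        rw [integral_indicator_const _ (hs.symmDiff hB), smul_eq_mul, mul_comm]

variable {S : Type*} {t : ℤ}

lemma history_map_shift (t : ℤ) (z : (ℤ → Fin 2) × (ℤ → S)) :
    history t (Prod.map shift shift z) = Prod.map shift shift (history (t + 1) z) := by
  refine Prod.ext (funext fun r => ?_) rfl
  simp [history, trunc, shift]

lemma innovation_map_shift {G : ℤ → (ℤ → Fin 2) → (ℤ → S) → ℝ}
    (hshift : ∀ t y x, G t (shift y) (shift x) = G (t + 1) y x) (z : (ℤ → Fin 2) × (ℤ → S)) :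
    innovation G t (Prod.map shift shift z) = innovation G (t + 1) z :=
  congrArg _ (hshift t z.1 z.2)

variable [MeasurableSpace S] {G : ℤ → (ℤ → Fin 2) → (ℤ → S) → ℝ}
  {Q : Measure ((ℤ → Fin 2) × (ℤ → S))} {s : Set ((ℤ → Fin 2) × (ℤ → S))}

-- An event in the past of `N` is moved by the shift into the past of `t`, at the same distance
-- from the invariant event.
lemma exists_measureReal_symmDiff_history_le [IsFiniteMeasure Q]
    (hT : MeasurePreserving (Prod.map shift shift) Q Q) (hs : MeasurableSet s)
    (hinv : Prod.map shift shift ⁻¹' s = s) (t : ℤ) {ε : ℝ} (hε : 0 < ε) :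
    ∃ D, MeasurableSet D ∧ Q.real (symmDiff s (history t ⁻¹' D)) ≤ ε := by
  set e : ((ℤ → Fin 2) × (ℤ → S)) ≃ᵐ ((ℤ → Fin 2) × (ℤ → S)) :=
    (shiftEquiv (Fin 2)).prodCongr (shiftEquiv S)
  have hinv' : e.symm ⁻¹' s = s := by
    conv_lhs => rw [← hinv]
    exact e.toEquiv.symm_preimage_preimage s
  have hstep (M : ℤ) (z) : history M (e.symm z) = e.symm (history (M - 1) z) := by
    have h := history_map_shift (M - 1) (e.symm z)
    rw [sub_add_cancel] at h
    exact (e.symm_apply_apply _).symm.trans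
      (congrArg e.symm (h.symm.trans (congrArg (history (M - 1)) (e.apply_symm_apply z))))
  have hhist (n : ℕ) (M : ℤ) (z) : history M (e.symm^[n] z) = e.symm^[n] (history (M - n) z) := by
    induction n generalizing M z with
    | zero => simp
    | succ n ih =>
      rw [Function.iterate_succ_apply, Function.iterate_succ_apply, ih, hstep, sub_sub,
        Nat.cast_succ]
  obtain ⟨_, ⟨N, D, hD, rfl⟩, hB⟩ :=
    (Measure.MeasureDense.of_generateFrom_isSetAlgebra_finite Q isSetAlgebra_pastEvents
      generateFrom_pastEvents.symm).approx s hs (measure_ne_top _ _) ε hε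
  set n := ((N : ℤ) - t).toNat
  have hiter := (MeasurePreserving.symm e hT).iterate n
  have hDm : MeasurableSet (history N ⁻¹' D) := measurable_history _ hD
  refine ⟨e.symm^[n] ⁻¹' (history N ⁻¹' D), hiter.measurable hDm, ?_⟩
  have hpast : history t ⁻¹' (e.symm^[n] ⁻¹' (history N ⁻¹' D))
      = e.symm^[n] ⁻¹' (history N ⁻¹' D) := by
    ext z
    simp only [Set.mem_preimage, hhist, history_history_of_le (show N - (n : ℤ) ≤ t by omega)]
  have hfix : e.symm^[n] ⁻¹' s = s :=
    Function.IsFixedPt.preimage_iterate (f := e.symm) hinv' n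
  have hsymmDiff : symmDiff s (e.symm^[n] ⁻¹' (history N ⁻¹' D))
      = e.symm^[n] ⁻¹' (symmDiff s (history N ⁻¹' D)) := by
    rw [Set.preimage_symmDiff, hfix]
  rw [hpast, hsymmDiff, measureReal_def,
    hiter.measure_preimage (hs.symmDiff hDm).nullMeasurableSet]
  exact ENNReal.toReal_le_of_le_ofReal hε.le hB.le

lemma measurable_map_shift :
    Measurable (Prod.map shift shift : (ℤ → Fin 2) × (ℤ → S) → (ℤ → Fin 2) × (ℤ → S)) :=
  measurable_shift.prodMap measurable_shift

namespace IsCompatible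

lemma map_shift [IsFiniteMeasure Q] (hQ : IsCompatible G Q) (hG : IsEnvironmentTransition G)
    (hshift : ∀ t y x, G t (shift y) (shift x) = G (t + 1) y x) :
    IsCompatible G (Q.map (Prod.map shift shift)) := by
  intro t h c hh hc
  rw [integral_map measurable_map_shift.aemeasurable
    (hG.integrable_comp_history_mul_innovation t hh hc).aestronglyMeasurable]
  simp only [history_map_shift, innovation_map_shift hshift]
  exact hQ (t + 1) (h ∘ Prod.map shift shift) c (hh.comp measurable_map_shift) fun z => hc _

theorem measurePreserving [IsFiniteMeasure Q] (hQ : IsCompatible G Q)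
    (hG : IsEnvironmentTransition G)
    (hshift : ∀ t y x, G t (shift y) (shift x) = G (t + 1) y x)
    (hπ : MeasurePreserving shift (Q.map Prod.snd) (Q.map Prod.snd))
    (hforget : ∀ᵐ x ∂(Q.map Prod.snd), Forgets fun t y => G t y x) :
    MeasurePreserving (Prod.map shift shift) Q Q := by
  refine ⟨measurable_map_shift, (hQ.unique (hQ.map_shift hG hshift) hG ?_ hforget).symm⟩
  rw [Measure.map_map measurable_snd measurable_map_shift]
  conv_lhs => rw [← hπ.map_eq, Measure.map_map measurable_shift measurable_snd]
  rfl

lemma setIntegral_history_preimage (hQ : IsCompatible G Q) {h : (ℤ → Fin 2) × (ℤ → S) → ℝ} {c : ℝ}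
    (hh : Measurable h) (hc : ∀ z, |h z| ≤ c) {D : Set ((ℤ → Fin 2) × (ℤ → S))}
    (hD : MeasurableSet D) :
    ∫ z in history t ⁻¹' D, h (history t z) * innovation G t z ∂Q = 0 := by
  have hbound (z) : |D.indicator h z| ≤ c := by
    by_cases hz : z ∈ D
    · simpa [hz] using hc z
    · simpa [hz] using (abs_nonneg _).trans (hc z)
  rw [← integral_indicator (measurable_history t hD),
    ← hQ t (D.indicator h) c (hh.indicator hD) hbound]
  simp only [Set.indicator_mul_left]
  rfl

lemma cond_of_invariant [IsFiniteMeasure Q] (hQ : IsCompatible G Q)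
    (hG : IsEnvironmentTransition G) (hT : MeasurePreserving (Prod.map shift shift) Q Q)
    (hs : MeasurableSet s) (hinv : Prod.map shift shift ⁻¹' s = s) : IsCompatible G Q[|s] := by
  intro t h c hh hc
  set k := fun z => h (history t z) * innovation G t z
  have hk : Measurable k := (hh.comp (measurable_history t)).mul (hG.measurable_innovation t)
  have hkc (z) : |k z| ≤ |c| := hG.abs_mul_innovation_le t ((hc _).trans (le_abs_self c)) z
  have hsmall (ε : ℝ) (hε : 0 < ε) : |∫ z in s, k z ∂Q| ≤ |c| * ε := by
    obtain ⟨D, hD, hle⟩ := exists_measureReal_symmDiff_history_le hT hs hinv t hε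
    have hsub := abs_setIntegral_sub_setIntegral_le hk hkc hs (measurable_history t hD) (μ := Q)
    rw [hQ.setIntegral_history_preimage hh hc hD, sub_zero] at hsub
    exact hsub.trans (mul_le_mul_of_nonneg_left hle (abs_nonneg c))
  have hlim : Tendsto (fun ε : ℝ => |c| * ε) (𝓝[>] 0) (𝓝 0) := by
    simpa using (tendsto_id.const_mul |c|).mono_left (nhdsWithin_le_nhds (a := (0 : ℝ)))
  have hzero : ∫ z in s, k z ∂Q = 0 := abs_nonpos_iff.1
    (ge_of_tendsto hlim (eventually_nhdsWithin_of_forall hsmall))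
  rw [ProbabilityTheory.cond, integral_smul_measure, hzero, smul_zero]

theorem ergodic [IsProbabilityMeasure Q] (hQ : IsCompatible G Q)
    (hG : IsEnvironmentTransition G)
    (hshift : ∀ t y x, G t (shift y) (shift x) = G (t + 1) y x)
    (hπ : Ergodic shift (Q.map Prod.snd))
    (hforget : ∀ᵐ x ∂(Q.map Prod.snd), Forgets fun t y => G t y x) :
    Ergodic (Prod.map shift shift) Q := by
  have hT := hQ.measurePreserving hG hshift hπ.toMeasurePreserving hforget
  refine ⟨hT, ⟨fun s hs hinv => eventuallyConst_set'.2 ?_⟩⟩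
  rcases eq_or_ne (Q s) 0 with h0 | h0
  · exact Or.inl (ae_eq_empty.2 h0)
  have hcond := hQ.cond_of_invariant hG hT hs hinv
  have hprob : IsProbabilityMeasure Q[|s] := cond_isProbabilityMeasure h0
  have hcondT : MeasurePreserving (Prod.map shift shift) Q[|s] Q[|s] := by
    have := hT.restrict_preimage hs
    rw [hinv] at this
    exact this.smul_measure _
  have hcondπ : MeasurePreserving shift (Q[|s].map Prod.snd) (Q[|s].map Prod.snd) :=
    (measurable_snd.measurePreserving Q[|s]).of_semiconj hcondT (fun _ => rfl) measurable_shift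
  have := Measure.isProbabilityMeasure_map (μ := Q) measurable_snd.aemeasurable
  have := Measure.isProbabilityMeasure_map (μ := Q[|s]) measurable_snd.aemeasurable
  have hmarg : Q[|s].map Prod.snd = Q.map Prod.snd :=
    hπ.eq_of_absolutelyContinuous hcondπ (cond_absolutelyContinuous.map measurable_snd)
  have heq : Q = Q[|s] := hQ.unique hcond hG hmarg.symm hforget
  refine Or.inr (eventuallyEq_univ.2 ?_)
  rw [mem_ae_iff, heq, cond_apply hs]
  simp

end IsCompatible

end Ergodicity

section JointPath

variable {Ω S : Type*} {Y : ℤ → Ω → Fin 2} {X : ℤ → Ω → S}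

/-- The paths of the responses and of the covariates, as a point of the space on which
compatible measures live. -/
def jointPath (Y : ℤ → Ω → Fin 2) (X : ℤ → Ω → S) (ω : Ω) : (ℤ → Fin 2) × (ℤ → S) :=
  (fun t => Y t ω, fun t => X t ω)

lemma indicator_response_eq (Y : ℤ → Ω → Fin 2) (t : ℤ) :
    Set.indicator {ω | Y t ω = 1} (fun _ => (1 : ℝ)) = fun ω => ((Y t ω : ℕ) : ℝ) := by
  funext ω
  rcases (by omega : Y t ω = 0 ∨ Y t ω = 1) with h | h <;> simp [h]

variable [MeasurableSpace S]

lemma pastAndCovariates_eq_comap (Y : ℤ → Ω → Fin 2) (X : ℤ → Ω → S) (t : ℤ) :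
    pastAndCovariates Y X t
      = MeasurableSpace.comap (fun ω => history t (jointPath Y X ω)) inferInstance := by
  refine le_antisymm (sup_le (iSup_le fun s => ?_) (iSup_le fun s => ?_)) ?_
  · have happly (ω : Ω) : (history t (jointPath Y X ω)).1 s = Y s ω := if_pos s.2
    rintro _ ⟨A, hA, rfl⟩
    exact ⟨_, (measurable_pi_apply (s : ℤ)).comp measurable_fst hA, by
      ext ω; simp only [Set.mem_preimage, Function.comp, happly]⟩
  · rintro _ ⟨A, hA, rfl⟩
    exact ⟨_, (measurable_pi_apply s).comp measurable_snd hA, rfl⟩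
  · rw [← measurable_iff_comap_le]
    refine Measurable.prodMk (@measurable_pi_lambda _ _ _ (_) _ _ fun s => ?_)
      (@measurable_pi_lambda _ _ _ (_) _ _ fun s => measurable_iff_comap_le.2
        (le_sup_of_le_right (le_iSup (fun s => MeasurableSpace.comap (X s) inferInstance) s)))
    by_cases hs : s < t
    · simp only [jointPath, trunc, if_pos hs]
      exact measurable_iff_comap_le.2 (le_sup_of_le_left
        (le_iSup (fun s : {s : ℤ // s < t} => MeasurableSpace.comap (Y s) inferInstance) ⟨s, hs⟩))
    · simp only [jointPath, trunc, if_neg hs, measurable_const]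

variable [mΩ : MeasurableSpace Ω]

lemma measurable_jointPath (hY : ∀ t, Measurable (Y t)) (hX : ∀ t, Measurable (X t)) :
    Measurable (jointPath Y X) :=
  (measurable_pi_lambda _ hY).prodMk (measurable_pi_lambda _ hX)

lemma pastAndCovariates_le (hJ : Measurable (jointPath Y X)) (t : ℤ) :
    pastAndCovariates Y X t ≤ mΩ := by
  rw [pastAndCovariates_eq_comap]
  exact ((measurable_history t).comp hJ).comap_le

variable {P : Measure Ω} [IsFiniteMeasure P] {G : ℤ → (ℤ → Fin 2) → (ℤ → S) → ℝ}
  {h : (ℤ → Fin 2) × (ℤ → S) → ℝ} {c : ℝ} {k : Ω → ℝ} {t : ℤ}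

lemma integrable_response (hJ : Measurable (jointPath Y X)) (t : ℤ) :
    Integrable (fun ω => ((Y t ω : ℕ) : ℝ)) P :=
  integrable_of_abs_le (((continuous_val_apply t).measurable.comp measurable_fst).comp hJ)
    fun ω => (Nat.abs_cast _).trans_le (val_apply_le_one t (jointPath Y X ω).1)

lemma integral_comp_history_mul_sub_eq_zero (hJ : Measurable (jointPath Y X))
    (hk : P[Set.indicator {ω | Y t ω = 1} (fun _ => (1 : ℝ)) | pastAndCovariates Y X t] =ᵐ[P] k)
    (hh : Measurable h) (hc : ∀ z, |h z| ≤ c) :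
    ∫ ω, h (history t (jointPath Y X ω)) * ((Y t ω : ℕ) - k ω) ∂P = 0 := by
  have hm := pastAndCovariates_le hJ t
  rw [indicator_response_eq] at hk
  set H := fun ω => h (history t (jointPath Y X ω))
  have hH : StronglyMeasurable[pastAndCovariates Y X t] H := by
    rw [pastAndCovariates_eq_comap]
    exact (hh.comp (comap_measurable _)).stronglyMeasurable
  have hbdd : ∀ᵐ ω ∂P, ‖H ω‖ ≤ c := Eventually.of_forall fun ω => hc _
  have hY := integrable_response (P := P) hJ t
  have hkint : Integrable k P := integrable_condExp.congr hk
  have hpull : P[H * fun ω => ((Y t ω : ℕ) : ℝ) | pastAndCovariates Y X t] =ᵐ[P] H * k :=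
    (condExp_stronglyMeasurable_mul_of_bound hm hH hY c hbdd).trans hk.mul_left
  have hHm := (hH.mono hm).aestronglyMeasurable (μ := P)
  calc ∫ ω, H ω * ((Y t ω : ℕ) - k ω) ∂P
      = ∫ ω, (H * fun ω => ((Y t ω : ℕ) : ℝ)) ω ∂P - ∫ ω, (H * k) ω ∂P := by
        simp only [mul_sub, Pi.mul_apply]
        exact integral_sub (hY.bdd_mul hHm hbdd) (hkint.bdd_mul hHm hbdd)
    _ = 0 := by rw [← integral_condExp hm, integral_congr_ae hpull, sub_self]

lemma condExp_of_isCompatible (hJ : Measurable (jointPath Y X)) (hG : IsEnvironmentTransition G)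
    (hQ : IsCompatible G (P.map (jointPath Y X))) (t : ℤ) :
    P[Set.indicator {ω | Y t ω = 1} (fun _ => (1 : ℝ)) | pastAndCovariates Y X t]
      =ᵐ[P] fun ω => G t (jointPath Y X ω).1 (jointPath Y X ω).2 := by
  have hm := pastAndCovariates_le hJ t
  have hY := integrable_response (P := P) hJ t
  have hGint : Integrable (fun ω => G t (jointPath Y X ω).1 (jointPath Y X ω).2) P :=
    integrable_of_abs_le ((hG.measurable t).comp hJ) (c := 1) fun ω =>
      (abs_of_nonneg (hG.nonneg _ _ _)).trans_le (hG.le_one _ _ _)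
  rw [indicator_response_eq]
  refine (ae_eq_condExp_of_forall_setIntegral_eq hm hY (fun s _ _ => hGint.integrableOn)
    (fun A hA _ => ?_) ?_).symm
  · rw [pastAndCovariates_eq_comap] at hA
    obtain ⟨D, hD, rfl⟩ := hA
    have hzero := hQ.setIntegral_history_preimage (t := t) (h := 1) (c := 1) measurable_one
      (fun z => by simp) hD
    simp only [Pi.one_apply, one_mul] at hzero
    rw [setIntegral_map (measurable_history t hD)
      (hG.measurable_innovation t).aestronglyMeasurable hJ.aemeasurable] at hzero
    exact (sub_eq_zero.1
      ((integral_sub hY.integrableOn hGint.integrableOn).symm.trans hzero)).symm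
  · rw [pastAndCovariates_eq_comap]
    have htrunc (ω : Ω) := apply_trunc_of_dependsOn (hG.dependsOn t (jointPath Y X ω).2)
      (jointPath Y X ω).1
    simp only [← htrunc]
    exact ((hG.measurable t).comp (comap_measurable
      fun ω => history t (jointPath Y X ω))).stronglyMeasurable.aestronglyMeasurable

theorem isCompatible_map_jointPath_iff (hJ : Measurable (jointPath Y X))
    (hG : IsEnvironmentTransition G) :
    IsCompatible G (P.map (jointPath Y X)) ↔
      ∀ t, P[Set.indicator {ω | Y t ω = 1} (fun _ => (1 : ℝ)) | pastAndCovariates Y X t]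
        =ᵐ[P] fun ω => G t (fun s => Y s ω) (fun s => X s ω) := by
  refine ⟨condExp_of_isCompatible hJ hG, fun hk t h c hh hc => ?_⟩
  rw [integral_map hJ.aemeasurable
    (hG.integrable_comp_history_mul_innovation t hh hc).aestronglyMeasurable]
  exact integral_comp_history_mul_sub_eq_zero hJ (hk t) hh hc

end JointPath

section StationaryPair

variable {Ω S : Type*} [MeasurableSpace Ω] [MeasurableSpace S] {P : Measure Ω}
  {Y : ℤ → Ω → Fin 2} {X : ℤ → Ω → S} {G : ℤ → (ℤ → Fin 2) → (ℤ → S) → ℝ}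
  {h : (ℤ → Fin 2) × (ℤ → S) → ℝ} {c : ℝ}

lemma integral_comp_history_mul_innovation_eq
    {Q : Measure ((ℤ → Fin 2) × (ℤ → S))} [IsFiniteMeasure Q] (hG : IsEnvironmentTransition G)
    (hshift : ∀ t y x, G t (shift y) (shift x) = G (t + 1) y x)
    (hT : MeasurePreserving (Prod.map shift shift) Q Q) (hh : Measurable h)
    (hc : ∀ z, |h z| ≤ c) (t : ℤ) (n : ℕ) :
    ∫ z, h (history t z) * innovation G t z ∂Q
      = ∫ z, h ((Prod.map shift shift)^[n] (history (t + n) z)) * innovation G (t + n) z ∂Q := by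
  induction n with
  | zero => simp
  | succ n ih =>
    let f := fun z => h ((Prod.map shift shift)^[n] (history (t + n) z)) * innovation G (t + n) z
    have hint : Integrable f (Q.map (Prod.map shift shift)) :=
      hG.integrable_comp_history_mul_innovation (t + n) (f := h ∘ (Prod.map shift shift)^[n])
        (hh.comp (hT.measurable.iterate n)) fun z => hc _
    rw [ih, ← hT.map_eq, integral_map hT.measurable.aemeasurable hint.aestronglyMeasurable,
      hT.map_eq]
    simp only [f, history_map_shift, innovation_map_shift hshift, Function.iterate_succ_apply,
      Nat.cast_succ, add_assoc]

variable [IsFiniteMeasure P]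

lemma abs_integral_comp_history_mul_innovation_le (hJ : Measurable (jointPath Y X))
    (hG : IsEnvironmentTransition G) {t : ℤ} {k : Ω → ℝ}
    (hk : P[Set.indicator {ω | Y t ω = 1} (fun _ => (1 : ℝ)) | pastAndCovariates Y X t] =ᵐ[P] k)
    (hh : Measurable h) (hc : ∀ z, |h z| ≤ c) :
    |∫ z, h (history t z) * innovation G t z ∂(P.map (jointPath Y X))|
      ≤ ∫ ω, c * |k ω - G t (jointPath Y X ω).1 (jointPath Y X ω).2| ∂P := by
  set H := fun ω => h (history t (jointPath Y X ω))
  have hint := hG.integrable_comp_history_mul_innovation (Q := P.map (jointPath Y X)) t hh hc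
  have hHm : Measurable H := (hh.comp (measurable_history t)).comp hJ
  have hkint : Integrable k P := integrable_condExp.congr hk
  have hGint : Integrable (fun ω => G t (jointPath Y X ω).1 (jointPath Y X ω).2) P :=
    integrable_of_abs_le ((hG.measurable t).comp hJ) (c := 1) fun ω =>
      (abs_of_nonneg (hG.nonneg _ _ _)).trans_le (hG.le_one _ _ _)
  have hHint {u : Ω → ℝ} (hu : Integrable u P) : Integrable (fun ω => H ω * u ω) P :=
    hu.bdd_mul hHm.aestronglyMeasurable (Eventually.of_forall fun ω => hc _)
  have hdiff : Integrable (fun ω => k ω - G t (jointPath Y X ω).1 (jointPath Y X ω).2) P :=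
    hkint.sub hGint
  have hres : Integrable (fun ω => ((Y t ω : ℕ) : ℝ) - k ω) P :=
    (integrable_response hJ t).sub hkint
  rw [integral_map hJ.aemeasurable hint.aestronglyMeasurable]
  calc _ = |∫ ω, (H ω * ((Y t ω : ℕ) - k ω)
          + H ω * (k ω - G t (jointPath Y X ω).1 (jointPath Y X ω).2)) ∂P| := by
        simp only [← mul_add, sub_add_sub_cancel]
        rfl
    _ = |∫ ω, H ω * (k ω - G t (jointPath Y X ω).1 (jointPath Y X ω).2) ∂P| := by
        rw [integral_add (hHint hres) (hHint hdiff),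
          integral_comp_history_mul_sub_eq_zero hJ hk hh hc, zero_add]
    _ ≤ ∫ ω, |H ω * (k ω - G t (jointPath Y X ω).1 (jointPath Y X ω).2)| ∂P :=
        abs_integral_le_integral_abs
    _ ≤ _ := by
        refine integral_mono (hHint hdiff).abs
          (hdiff.abs.const_mul c) fun ω => ?_
        simp only [abs_mul]
        exact mul_le_mul_of_nonneg_right (hc _) (abs_nonneg _)

-- Stationarity moves the defect at time `t` to time `t + n`, where it is small.
theorem isCompatible_of_tendsto_condExp (hJ : Measurable (jointPath Y X))
    (hG : IsEnvironmentTransition G) (hshift : ∀ t y x, G t (shift y) (shift x) = G (t + 1) y x)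
    (hT : MeasurePreserving (Prod.map shift shift) (P.map (jointPath Y X))
      (P.map (jointPath Y X)))
    {k : ℤ → Ω → ℝ} (hkm : ∀ t, Measurable (k t)) (hk0 : ∀ t ω, 0 ≤ k t ω)
    (hk1 : ∀ t ω, k t ω ≤ 1)
    (hk : ∀ t, P[Set.indicator {ω | Y t ω = 1} (fun _ => (1 : ℝ)) | pastAndCovariates Y X t]
      =ᵐ[P] k t)
    (hlim : ∀ t : ℤ, ∀ᵐ ω ∂P, Tendsto (fun n : ℕ => k (t + n) ω
      - G (t + n) (jointPath Y X ω).1 (jointPath Y X ω).2) atTop (𝓝 0)) :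
    IsCompatible G (P.map (jointPath Y X)) := by
  intro t h c hh hc
  have hle (n : ℕ) : |∫ z, h (history t z) * innovation G t z ∂(P.map (jointPath Y X))|
      ≤ ∫ ω, c * |k (t + n) ω - G (t + n) (jointPath Y X ω).1 (jointPath Y X ω).2| ∂P := by
    rw [integral_comp_history_mul_innovation_eq hG hshift hT hh hc t n]
    exact abs_integral_comp_history_mul_innovation_le (P := P) (t := t + n)
      (h := h ∘ (Prod.map shift shift)^[n]) hJ hG (hk _)
      (hh.comp (hT.measurable.iterate n)) fun z => hc _
  have hbound (n : ℕ) (ω : Ω) :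
      ‖c * |k (t + n) ω - G (t + n) (jointPath Y X ω).1 (jointPath Y X ω).2|‖ ≤ |c| := by
    rw [Real.norm_eq_abs, abs_mul, abs_abs]
    exact mul_le_of_le_one_right (abs_nonneg c) ((abs_sub_le_of_le_of_le (hk0 _ _) (hk1 _ _)
      (hG.nonneg _ _ _) (hG.le_one _ _ _)).trans (by norm_num))
  have hconv : Tendsto (fun n : ℕ => ∫ ω, c * |k (t + n) ω
      - G (t + n) (jointPath Y X ω).1 (jointPath Y X ω).2| ∂P) atTop (𝓝 (∫ _, (0 : ℝ) ∂P)) := by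
    refine tendsto_integral_of_dominated_convergence (fun _ => |c|)
      (fun n => (((hkm _).sub ((hG.measurable _).comp hJ)).abs.const_mul c).aestronglyMeasurable)
      (integrable_const _) (fun n => Eventually.of_forall (hbound n)) ?_
    filter_upwards [hlim t] with ω hω
    simpa using hω.abs.const_mul c
  rw [integral_zero] at hconv
  exact abs_nonpos_iff.1 (ge_of_tendsto' hconv hle)

end StationaryPair

/-! ### Solutions of the model -/

section Recursion

variable {E : Type*} [NormedAddCommGroup E] [InnerProductSpace ℝ E] {q p : ℕ} {β α : ℕ → ℝ}
  {γ : E} {C ρ : ℝ} {x : ℤ → E}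

lemma Tame.tendsto_pow_mul_latent (hx : Tame ρ x) (hM : HasPowerDecay q β C ρ) (y : ℤ → Fin 2)
    (t : ℤ) :
    Tendsto (fun n : ℕ => ρ ^ n * |latent q p β α γ (t - n) y x|) atTop (𝓝 0) := by
  have hρ := hM.rate_pos.le
  have hsum := hx.summable_input (p := p) (α := α) (γ := γ) hM.rate_pos hM.rate_lt_one y
  have htail : Tendsto (fun n : ℕ => C * ∑' m : ℕ,
      ρ ^ (m + n) * |input p α γ (t - (m + n : ℕ)) y x|) atTop (𝓝 0) := by
    simpa using (tendsto_sum_nat_add fun m => ρ ^ m * |input p α γ (t - m) y x|).const_mul C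
  refine squeeze_zero (fun n => by positivity) (fun n => ?_) htail
  have hterm (m : ℕ) : ‖ρ ^ n * (impulse q β m * input p α γ (t - n - m) y x)‖
      ≤ C * (ρ ^ (m + n) * |input p α γ (t - (m + n : ℕ)) y x|) := by
    rw [Real.norm_eq_abs, abs_mul, abs_mul, abs_of_nonneg (pow_nonneg hρ n), pow_add,
      Nat.cast_add, add_comm (m : ℤ), ← sub_sub]
    calc ρ ^ n * (|impulse q β m| * |input p α γ (t - n - m) y x|)
        ≤ ρ ^ n * (C * ρ ^ m * |input p α γ (t - n - m) y x|) := by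
          gcongr
          exact hM.abs_le m 0 0
      _ = _ := by ring
  rw [← abs_of_nonneg (pow_nonneg hρ n), ← abs_mul, latent, ← tsum_mul_left, ← tsum_mul_left]
  exact tsum_of_norm_bounded
    (((summable_nat_add_iff n).2 (hsum t)).mul_left C).hasSum hterm

lemma Tame.sub_latent_eq (hx : Tame ρ x) (hM : HasPowerDecay q β C ρ) {y : ℤ → Fin 2} {m : ℤ → ℝ}
    (hm : ∀ t, m t = ∑ j ∈ Finset.Icc 1 q, β j * m (t - (j : ℤ))
      + ∑ k ∈ Finset.Icc 1 p, α k * ((y (t - (k : ℤ)) : ℕ) : ℝ) + inner ℝ γ (x t)) (t : ℤ) :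
    m t - latent q p β α γ t y x = ∑ j ∈ Finset.Icc 1 q,
      β j * (m (t - (j : ℤ)) - latent q p β α γ (t - (j : ℤ)) y x) := by
  rw [hm t, hx.latent_eq hM y t]
  simp only [mul_sub, Finset.sum_sub_distrib]
  ring

theorem Tame.tendsto_sub_latent (hx : Tame ρ x) (hM : HasPowerDecay q β C ρ) {y : ℤ → Fin 2}
    {m : ℤ → ℝ} (hm : ∀ t, m t = ∑ j ∈ Finset.Icc 1 q, β j * m (t - (j : ℤ))
      + ∑ k ∈ Finset.Icc 1 p, α k * ((y (t - (k : ℤ)) : ℕ) : ℝ) + inner ℝ γ (x t)) (t : ℤ) :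
    Tendsto (fun n : ℕ => m (t + n) - latent q p β α γ (t + n) y x) atTop (𝓝 0) := by
  have hgeom := ((tendsto_pow_atTop_nhds_zero_of_lt_one hM.rate_pos.le
    hM.rate_lt_one).const_mul C).mul_const
      (∑ j : Fin (q + 1), |m (t - (j : ℕ)) - latent q p β α γ (t - (j : ℕ)) y x|)
  rw [mul_zero, zero_mul] at hgeom
  refine squeeze_zero_norm (fun n => ?_) hgeom
  simpa using hM.abs_le_of_homogeneous (hx.sub_latent_eq hM hm) (t + n) n

-- The window carries the whole state of the homogeneous recursion, which is then contracted by
-- `ρ ^ n` on the way to time `t`; windows arbitrarily far in the past leave nothing.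
theorem Tame.eq_latent (hx : Tame ρ x) (hM : HasPowerDecay q β C ρ) {y : ℤ → Fin 2} {m : ℤ → ℝ}
    (hm : ∀ t, m t = ∑ j ∈ Finset.Icc 1 q, β j * m (t - (j : ℤ))
      + ∑ k ∈ Finset.Icc 1 p, α k * ((y (t - (k : ℤ)) : ℕ) : ℝ) + inner ℝ γ (x t))
    {R : ℝ} (hR : ∀ T : ℤ, ∃ s < T, ∀ r, s ≤ r → r < s + (q + 1 : ℕ) → |m r| ≤ R) (t : ℤ) :
    m t = latent q p β α γ t y x := by
  have hρ := hM.rate_pos.le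
  have hlim : Tendsto (fun n : ℕ => C * ∑ j : Fin (q + 1),
      (ρ ^ n * R + ρ ^ n * |latent q p β α γ (t - (j : ℕ) - n) y x|)) atTop (𝓝 0) := by
    have hgeom := (tendsto_pow_atTop_nhds_zero_of_lt_one hρ hM.rate_lt_one).mul_const R
    simpa using (tendsto_finsetSum Finset.univ fun (j : Fin (q + 1)) _ =>
      hgeom.add (hx.tendsto_pow_mul_latent (p := p) (α := α) (γ := γ) hM y (t - (j : ℕ)))).const_mul
        C
  refine sub_eq_zero.1 (abs_nonpos_iff.1 (ge_of_tendsto_of_frequently hlim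
    (frequently_atTop.2 fun N => ?_)))
  obtain ⟨s, hs, hwin⟩ := hR (t - N - q)
  obtain ⟨n, hn⟩ := Int.eq_ofNat_of_zero_le (a := t - s - q) (by omega)
  refine ⟨n, by omega, (hM.abs_le_of_homogeneous (hx.sub_latent_eq hM hm) t n).trans ?_⟩
  rw [mul_assoc, Finset.mul_sum]
  refine mul_le_mul_of_nonneg_left (Finset.sum_le_sum fun j _ => ?_) hM.const_nonneg
  rw [← mul_add, sub_right_comm t (j : ℤ)]
  exact mul_le_mul_of_nonneg_left ((abs_sub _ _).trans
    (add_le_add_left (hwin _ (by omega) (by omega)) _)) (pow_nonneg hρ n)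

end Recursion

section ResponseProb

lemma IsTransition.continuous {g : ℤ → (ℤ → Fin 2) → ℝ} {b : ℕ → ℝ} (hg : IsTransition g b)
    (hb : Tendsto b atTop (𝓝 0)) (t : ℤ) : Continuous (g t) :=
  continuous_of_oscLE fun _ hε =>
    (hb.eventually (ge_mem_nhds hε)).exists.imp fun k hk => (hg.osc t k).mono le_rfl hk

lemma exists_forall_sum_range_add_le {b : ℕ → ℝ} (hb0 : ∀ n, 0 ≤ b n) (hb : Summable b) {ε : ℝ}
    (hε : 0 < ε) : ∃ m : ℕ, ∀ j, ∑ i ∈ Finset.range j, b (m + i) ≤ ε := by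
  obtain ⟨m, hm⟩ := ((tendsto_sum_nat_add b).eventually (ge_mem_nhds hε)).exists
  refine ⟨m, fun j => ?_⟩
  simp only [add_comm m]
  exact (((summable_nat_add_iff m).2 hb).sum_le_tsum _ fun i _ => hb0 _).trans hm

variable {E : Type*} [NormedAddCommGroup E] [InnerProductSpace ℝ E]

/-- The transition probabilities `F(μ_t)` of the model, with `μ` its causal latent process. -/
noncomputable def responseProb (F : ℝ → ℝ) (q p : ℕ) (β α : ℕ → ℝ) (γ : E) (t : ℤ)
    (y : ℤ → Fin 2) (x : ℤ → E) : ℝ :=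
  F (latent q p β α γ t y x)

variable {F : ℝ → ℝ} {q p : ℕ} {β α : ℕ → ℝ} {γ : E} {C ρ : ℝ} {x : ℤ → E} {L : NNReal}

lemma responseProb_shift (t : ℤ) (y : ℤ → Fin 2) (x : ℤ → E) :
    responseProb F q p β α γ t (shift y) (shift x) = responseProb F q p β α γ (t + 1) y x :=
  congrArg F (latent_shift t y x)

lemma dependsOn_latent (t : ℤ) (x : ℤ → E) :
    DependsOn (fun y => latent q p β α γ t y x) (Set.Iio t) := fun y y' h => by
  refine tsum_congr fun n => congrArg _ (congrArg (· + _) (Finset.sum_congr rfl fun k hk => ?_))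
  rw [h _ (Set.mem_Iio.2 (by have := (Finset.mem_Icc.1 hk).1; omega))]

lemma Tame.isTransition_responseProb (hx : Tame ρ x) (hM : HasPowerDecay q β C ρ)
    (hF0 : ∀ v, 0 ≤ F v) (hF1 : ∀ v, F v ≤ 1) (hFL : LipschitzWith L F) :
    IsTransition (fun t y => responseProb F q p β α γ t y x)
      fun k => L * latentConst p α C ρ * √ρ ^ k where
  nonneg _ _ := hF0 _
  le_one _ _ := hF1 _
  osc t k y y' hy := by
    rw [mul_assoc]
    exact (hFL.dist_le_mul _ _).trans
      (mul_le_mul_of_nonneg_left (hx.oscLE_latent hM t k y y' hy) L.2)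

lemma HasPowerDecay.summable_modulus (hM : HasPowerDecay q β C ρ) (a : ℝ) :
    Summable fun k : ℕ => a * √ρ ^ k :=
  (summable_geometric_of_lt_one (Real.sqrt_nonneg ρ) hM.sqrt_lt_one).mul_left a

lemma Tame.continuous_responseProb (hx : Tame ρ x) (hM : HasPowerDecay q β C ρ)
    (hF0 : ∀ v, 0 ≤ F v) (hF1 : ∀ v, F v ≤ 1) (hFL : LipschitzWith L F) (t : ℤ) :
    Continuous fun y => responseProb F q p β α γ t y x :=
  (hx.isTransition_responseProb hM hF0 hF1 hFL).continuous
    (hM.summable_modulus _).tendsto_atTop_zero t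

lemma Tame.tendsto_sub_responseProb (hx : Tame ρ x) (hM : HasPowerDecay q β C ρ)
    (hFL : LipschitzWith L F) {y : ℤ → Fin 2} {m : ℤ → ℝ}
    (hm : ∀ t, m t = ∑ j ∈ Finset.Icc 1 q, β j * m (t - (j : ℤ))
      + ∑ k ∈ Finset.Icc 1 p, α k * ((y (t - (k : ℤ)) : ℕ) : ℝ) + inner ℝ γ (x t)) (t : ℤ) :
    Tendsto (fun n : ℕ => F (m (t + n)) - responseProb F q p β α γ (t + n) y x) atTop (𝓝 0) := by
  have hlim := (hx.tendsto_sub_latent hM hm t).norm.const_mul (L : ℝ)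
  rw [norm_zero, mul_zero] at hlim
  exact squeeze_zero_norm (fun n => hFL.norm_sub_le _ _) hlim

lemma Tame.abs_latent_le (hx : Tame ρ x) (hM : HasPowerDecay q β C ρ) (t : ℤ)
    (y y' : ℤ → Fin 2) :
    |latent q p β α γ t y x| ≤ |latent q p β α γ t y' x| + latentConst p α C ρ := by
  have hosc := hx.oscLE_latent (p := p) (α := α) (γ := γ) hM t 0 y y' fun r h1 h2 => by omega
  rw [pow_zero, mul_one] at hosc
  linarith [abs_sub_abs_le_abs_sub (latent q p β α γ t y x) (latent q p β α γ t y' x)]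

lemma exists_forall_abs_le_imp_le (hF : Continuous F) (hpos : ∀ v, 0 < F v) (R : ℝ) :
    ∃ δ > 0, ∀ v, |v| ≤ R → δ ≤ F v := by
  rcases lt_or_ge R 0 with hR | hR
  · exact ⟨1, one_pos, fun v hv => absurd ((abs_nonneg v).trans hv) hR.not_ge⟩
  obtain ⟨v₀, -, hmin⟩ := isCompact_Icc.exists_isMinOn (s := Set.Icc (-R) R)
    ⟨0, by simpa using hR⟩ hF.continuousOn
  exact ⟨F v₀, hpos v₀, fun v hv => hmin (abs_le.1 hv)⟩

variable [MeasurableSpace E] [OpensMeasurableSpace E] [SecondCountableTopology E]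

lemma isEnvironmentTransition_responseProb (hF : Measurable F) (hF0 : ∀ v, 0 ≤ F v)
    (hF1 : ∀ v, F v ≤ 1) : IsEnvironmentTransition (responseProb F q p β α γ) where
  measurable _ := hF.comp (measurable_latent
    (fun s _ => (measurable_pi_apply s).comp measurable_fst)
    fun s => (measurable_pi_apply s).comp measurable_snd)
  nonneg _ _ _ := hF0 _
  le_one _ _ _ := hF1 _
  dependsOn _ _ _ _ h := congrArg F (dependsOn_latent _ _ h)

-- Where the latent process with responses `0` is bounded, the latent process is bounded uniformly
-- in the responses, and the transition probabilities are bounded away from `0`.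
theorem ae_forgets_responseProb {π : Measure (ℤ → E)} [IsFiniteMeasure π]
    (hπ : MeasurePreserving shift π π) (hM : HasPowerDecay q β C ρ) (htame : ∀ᵐ x ∂π, Tame ρ x)
    (hpos : ∀ v, 0 < F v) (hF1 : ∀ v, F v ≤ 1) (hFL : LipschitzWith L F) :
    ∀ᵐ x ∂π, Forgets fun t y => responseProb F q p β α γ t y x := by
  have hsum := hM.summable_modulus (L * latentConst p α C ρ)
  obtain ⟨m, hm⟩ := exists_forall_sum_range_add_le (fun n => mul_nonneg
    (mul_nonneg L.2 hM.latentConst_nonneg) (by positivity)) hsum (half_pos one_pos)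
  filter_upwards [htame, ae_exists_recurrent_window hπ
    (V := fun t x => latent q p β α γ t 0 x)
    (fun t => measurable_latent (fun _ _ => measurable_const) measurable_pi_apply)
    (fun t x => latent_shift t 0 x) m] with x hx ⟨R, hR⟩
  refine (hx.isTransition_responseProb hM (fun v => (hpos v).le) hF1 hFL).forgets
    hsum.tendsto_atTop_zero hm ?_
  obtain ⟨δ, hδ, hδF⟩ :=
    exists_forall_abs_le_imp_le hFL.continuous hpos (R + latentConst p α C ρ)
  refine ⟨δ, hδ, fun T => ?_⟩
  obtain ⟨s, hs, hsR⟩ := hR T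
  exact ⟨s, hs, fun r h1 h2 y => hδF _
    ((hx.abs_latent_le hM r y 0).trans (by linarith [hsR r h1 h2]))⟩

end ResponseProb

section Laws

variable {Ω S : Type*} [MeasurableSpace Ω] [MeasurableSpace S] {P : Measure Ω}
  {Y : ℤ → Ω → Fin 2} {X : ℤ → Ω → S}

instance isFiniteMeasure_law [IsFiniteMeasure P] : IsFiniteMeasure (law P X) :=
  Measure.isFiniteMeasure_map _ _

lemma map_snd_map_jointPath (hJ : Measurable (jointPath Y X)) :
    (P.map (jointPath Y X)).map Prod.snd = law P X :=
  Measure.map_map measurable_snd hJ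

lemma law_comp_snd {𝒲 : Type*} [MeasurableSpace 𝒲] {R : Measure (𝒲 × Ω)}
    (hX : ∀ t, Measurable (X t)) (hR : R.map Prod.snd = P) :
    law R (fun t ω => X t ω.2) = law P X := by
  rw [← hR]
  exact (Measure.map_map (measurable_pi_lambda _ hX) measurable_snd).symm

lemma law_prodMk (hJ : Measurable (jointPath Y X)) :
    law P (fun t ω => (Y t ω, X t ω)) = (P.map (jointPath Y X)).map
      (MeasurableEquiv.arrowProdEquivProdArrow (Fin 2) S ℤ).symm := by
  rw [Measure.map_map (MeasurableEquiv.measurable _) hJ]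
  rfl

lemma IsStationary.measurePreserving_map_jointPath
    (h : IsStationary P fun t ω => (Y t ω, X t ω)) :
    MeasurePreserving (Prod.map shift shift) (P.map (jointPath Y X)) (P.map (jointPath Y X)) := by
  let e := MeasurableEquiv.arrowProdEquivProdArrow (Fin 2) S ℤ
  have he : MeasurePreserving e (law P fun t ω => (Y t ω, X t ω)) (P.map (jointPath Y X)) :=
    ⟨e.measurable, Measure.map_map e.measurable (measurable_pi_lambda _ h.1)⟩
  exact he.of_semiconj h.2 (fun _ => rfl) measurable_map_shift

lemma isStationaryErgodic_prodMk (hY : ∀ t, Measurable (Y t)) (hX : ∀ t, Measurable (X t))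
    (hQ : Ergodic (Prod.map shift shift) (P.map (jointPath Y X))) :
    IsStationaryErgodic P fun t ω => (Y t ω, X t ω) := by
  refine ⟨fun t => (hY t).prodMk (hX t), ?_⟩
  rw [law_prodMk (measurable_jointPath hY hX)]
  exact ((MeasurableEquiv.measurable _).measurePreserving _).ergodic_of_ergodic_semiconj hQ
    measurable_shift fun _ => rfl

lemma IsCompatible.map_jointPath_eq {Ω' : Type*} [MeasurableSpace Ω'] {P' : Measure Ω'}
    [IsFiniteMeasure P] [IsFiniteMeasure P'] {Y' : ℤ → Ω' → Fin 2} {X' : ℤ → Ω' → S}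
    {G : ℤ → (ℤ → Fin 2) → (ℤ → S) → ℝ} (hQ : IsCompatible G (P.map (jointPath Y X)))
    (hQ' : IsCompatible G (P'.map (jointPath Y' X'))) (hG : IsEnvironmentTransition G)
    (hJ : Measurable (jointPath Y X)) (hJ' : Measurable (jointPath Y' X'))
    (hlaw : law P X = law P' X') (hforget : ∀ᵐ x ∂(law P X), Forgets fun t y => G t y x) :
    P.map (jointPath Y X) = P'.map (jointPath Y' X') :=
  hQ.unique hQ' hG (by rw [map_snd_map_jointPath hJ, map_snd_map_jointPath hJ', hlaw])
    (by rwa [map_snd_map_jointPath hJ])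

lemma IsCompatible.ergodic_map_jointPath [IsProbabilityMeasure P]
    {G : ℤ → (ℤ → Fin 2) → (ℤ → S) → ℝ} (hQ : IsCompatible G (P.map (jointPath Y X)))
    (hG : IsEnvironmentTransition G)
    (hshift : ∀ t y x, G t (shift y) (shift x) = G (t + 1) y x) (hJ : Measurable (jointPath Y X))
    (hX : Ergodic shift (law P X)) (hforget : ∀ᵐ x ∂(law P X), Forgets fun t y => G t y x) :
    Ergodic (Prod.map shift shift) (P.map (jointPath Y X)) := by
  have : IsProbabilityMeasure (P.map (jointPath Y X)) :=
    Measure.isProbabilityMeasure_map hJ.aemeasurable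
  rw [← map_snd_map_jointPath hJ] at hX hforget
  exact hQ.ergodic hG hshift hX hforget

theorem exists_isCompatible_map_jointPath {G : ℤ → (ℤ → Fin 2) → (ℤ → S) → ℝ}
    (hG : IsEnvironmentTransition G) [IsProbabilityMeasure P] (hX : ∀ t, Measurable (X t))
    (hcont : ∀ᵐ x ∂(law P X), ∀ t, Continuous fun y => G t y x)
    (hforget : ∀ᵐ x ∂(law P X), Forgets fun t y => G t y x) :
    ∃ R : Measure ((ℤ → Fin 2) × Ω), IsProbabilityMeasure R ∧ R.map Prod.snd = P ∧
      IsCompatible G (R.map (jointPath (fun t ω => ω.1 t) fun t ω => X t ω.2)) := by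
  have hXm := measurable_pi_lambda _ hX
  obtain ⟨R, hR, hRP, hRc⟩ := exists_isCompatible (hG.comp hXm) P
    (ae_of_ae_map hXm.aemeasurable hcont) (ae_of_ae_map hXm.aemeasurable hforget)
  exact ⟨R, hR, hRP, hRc.map_prodMap hG hXm⟩

end Laws

lemma IsStationaryErgodic.ae_tame {Ω E : Type*} [MeasurableSpace Ω] [NormedAddCommGroup E]
    [MeasurableSpace E] [OpensMeasurableSpace E] {P : Measure Ω} [IsProbabilityMeasure P]
    {X : ℤ → Ω → E} {s : ℤ} {ρ : ℝ} (hX : IsStationaryErgodic P X)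
    (hint : Integrable (fun ω => Real.posLog ‖X s ω‖) P) (hρ0 : 0 < ρ) (hρ1 : ρ < 1) :
    ∀ᵐ x ∂(law P X), Tame ρ x := by
  have hXm := measurable_pi_lambda _ hX.1
  have : IsProbabilityMeasure (law P X) := Measure.isProbabilityMeasure_map hXm.aemeasurable
  have hlog : Measurable fun x : ℤ → E => Real.posLog ‖x s‖ :=
    (measurable_const.max Real.measurable_log).comp (measurable_pi_apply s).norm
  exact BinaryAutoregression.ae_tame hX.2.toMeasurePreserving
    ((integrable_map_measure hlog.aestronglyMeasurable hXm.aemeasurable).2 hint) hρ0 hρ1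

section AdjoinLatent

variable {E : Type*} [NormedAddCommGroup E] [InnerProductSpace ℝ E] {q p : ℕ} {β α : ℕ → ℝ}
  {γ : E}

variable (q p β α γ) in
/-- The path of the triples of response, covariate and causal latent variable, as a function of
the paths of the responses and of the covariates. -/
noncomputable def adjoinLatent (z : (ℤ → Fin 2) × (ℤ → E)) : ℤ → Fin 2 × E × ℝ :=
  fun t => (z.1 t, z.2 t, latent q p β α γ t z.1 z.2)

lemma adjoinLatent_map_shift (z : (ℤ → Fin 2) × (ℤ → E)) :
    adjoinLatent q p β α γ (Prod.map shift shift z) = shift (adjoinLatent q p β α γ z) :=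
  funext fun t => congrArg (fun v => (z.1 (t + 1), z.2 (t + 1), v)) (latent_shift t z.1 z.2)

variable [MeasurableSpace E] [OpensMeasurableSpace E] [SecondCountableTopology E]

lemma measurable_adjoinLatent : Measurable (adjoinLatent q p β α γ) :=
  measurable_pi_lambda _ fun t => ((measurable_pi_apply t).comp measurable_fst).prodMk
    (((measurable_pi_apply t).comp measurable_snd).prodMk (measurable_latent
      (fun s _ => (measurable_pi_apply s).comp measurable_fst)
      fun s => (measurable_pi_apply s).comp measurable_snd))

variable {Ω : Type*} [MeasurableSpace Ω] {P : Measure Ω} {Y : ℤ → Ω → Fin 2} {X : ℤ → Ω → E}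
  {μ : ℤ → Ω → ℝ}

lemma law_prodMk_of_eq_latent (hJ : Measurable (jointPath Y X))
    (hμ : ∀ᵐ ω ∂P, ∀ t, μ t ω = latent q p β α γ t (fun s => Y s ω) (fun s => X s ω)) :
    law P (fun t ω => (Y t ω, X t ω, μ t ω))
      = (P.map (jointPath Y X)).map (adjoinLatent q p β α γ) := by
  rw [Measure.map_map measurable_adjoinLatent hJ]
  refine Measure.map_congr ?_
  filter_upwards [hμ] with ω hω
  simp only [hω]
  rfl

lemma isStationary_prodMk_latent (hY : ∀ t, Measurable (Y t)) (hX : ∀ t, Measurable (X t))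
    (hT : MeasurePreserving (Prod.map shift shift) (P.map (jointPath Y X))
      (P.map (jointPath Y X))) :
    IsStationary P fun t ω =>
      (Y t ω, X t ω, latent q p β α γ t (fun s => Y s ω) (fun s => X s ω)) := by
  refine ⟨fun t => (hY t).prodMk ((hX t).prodMk (measurable_latent (fun s _ => hY s) hX)), ?_⟩
  rw [law_prodMk_of_eq_latent (q := q) (p := p) (β := β) (α := α) (γ := γ)
    (measurable_jointPath hY hX) (Eventually.of_forall fun _ _ => rfl)]
  exact (measurable_adjoinLatent.measurePreserving _).of_semiconj hT adjoinLatent_map_shift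
    measurable_shift

end AdjoinLatent

section IsSolution

variable {d : ℕ} {F : ℝ → ℝ} {q p : ℕ} {β α : ℕ → ℝ} {γ : EuclideanSpace ℝ (Fin d)} {C ρ : ℝ}
  {Ω : Type*} [MeasurableSpace Ω] {P : Measure Ω} {X : ℤ → Ω → EuclideanSpace ℝ (Fin d)}
  {Y : ℤ → Ω → Fin 2} {μ : ℤ → Ω → ℝ}

lemma IsCompatible.isSolution_latent [IsFiniteMeasure P]
    (hQ : IsCompatible (responseProb F q p β α γ) (P.map (jointPath Y X)))
    (hF : Measurable F) (hF0 : ∀ v, 0 ≤ F v) (hF1 : ∀ v, F v ≤ 1) (hM : HasPowerDecay q β C ρ)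
    (hY : ∀ t, Measurable (Y t)) (hX : ∀ t, Measurable (X t))
    (htame : ∀ᵐ x ∂(law P X), Tame ρ x) :
    IsSolution F q p β α γ P X Y
      fun t ω => latent q p β α γ t (fun s => Y s ω) (fun s => X s ω) where
  measurable_covariate := hX
  measurable_response := hY
  measurable_latent t := BinaryAutoregression.measurable_latent (fun s _ => hY s) hX
  recursion t := by
    filter_upwards [ae_of_ae_map (measurable_pi_lambda _ hX).aemeasurable htame] with ω hω
    exact hω.latent_eq hM _ t
  condProb := (isCompatible_map_jointPath_iff (measurable_jointPath hY hX)
    (isEnvironmentTransition_responseProb hF hF0 hF1)).1 hQ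

namespace IsSolution

lemma measurable_jointPath (hsol : IsSolution F q p β α γ P X Y μ) :
    Measurable (jointPath Y X) :=
  BinaryAutoregression.measurable_jointPath hsol.measurable_response hsol.measurable_covariate

lemma ae_tame (hsol : IsSolution F q p β α γ P X Y μ) (htame : ∀ᵐ x ∂(law P X), Tame ρ x) :
    ∀ᵐ ω ∂P, Tame ρ fun s => X s ω :=
  ae_of_ae_map (measurable_pi_lambda _ hsol.measurable_covariate).aemeasurable htame

theorem ae_eq_latent_of_isStationary [IsFiniteMeasure P] (hsol : IsSolution F q p β α γ P X Y μ)
    (hM : HasPowerDecay q β C ρ) (htame : ∀ᵐ x ∂(law P X), Tame ρ x) (hμ : IsStationary P μ) :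
    ∀ᵐ ω ∂P, ∀ t, μ t ω = latent q p β α γ t (fun s => Y s ω) (fun s => X s ω) := by
  have hμm := measurable_pi_lambda _ hsol.measurable_latent
  filter_upwards [hsol.ae_tame htame, ae_all_iff.2 hsol.recursion,
    ae_of_ae_map hμm.aemeasurable (ae_exists_recurrent_window hμ.2 (V := fun t m => m t)
      measurable_pi_apply (fun _ _ => rfl) (q + 1))] with ω hx hm ⟨R, hR⟩
  exact hx.eq_latent hM (m := fun t => μ t ω) hm hR

theorem isCompatible_of_isStationary_latent [IsFiniteMeasure P]
    (hsol : IsSolution F q p β α γ P X Y μ) (hF : Measurable F) (hF0 : ∀ v, 0 ≤ F v)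
    (hF1 : ∀ v, F v ≤ 1) (hM : HasPowerDecay q β C ρ) (htame : ∀ᵐ x ∂(law P X), Tame ρ x)
    (hμ : IsStationary P μ) :
    IsCompatible (responseProb F q p β α γ) (P.map (jointPath Y X)) := by
  refine (isCompatible_map_jointPath_iff hsol.measurable_jointPath
    (isEnvironmentTransition_responseProb hF hF0 hF1)).2 fun t => ?_
  filter_upwards [hsol.condProb t, hsol.ae_eq_latent_of_isStationary hM htame hμ] with ω hk hω
  rw [hk, hω t, responseProb]

theorem isCompatible_of_isStationary_response [IsFiniteMeasure P]
    (hsol : IsSolution F q p β α γ P X Y μ) {L : NNReal} (hFL : LipschitzWith L F)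
    (hF0 : ∀ v, 0 ≤ F v) (hF1 : ∀ v, F v ≤ 1) (hM : HasPowerDecay q β C ρ)
    (htame : ∀ᵐ x ∂(law P X), Tame ρ x) (hYX : IsStationary P fun t ω => (Y t ω, X t ω)) :
    IsCompatible (responseProb F q p β α γ) (P.map (jointPath Y X)) := by
  have hF := hFL.continuous.measurable
  have hlim (t : ℤ) : ∀ᵐ ω ∂P, Tendsto (fun n : ℕ => F (μ (t + n) ω)
      - responseProb F q p β α γ (t + n) (jointPath Y X ω).1 (jointPath Y X ω).2) atTop (𝓝 0) := by
    filter_upwards [hsol.ae_tame htame, ae_all_iff.2 hsol.recursion] with ω hx hm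
    exact hx.tendsto_sub_responseProb hM hFL (m := fun t => μ t ω) hm t
  exact isCompatible_of_tendsto_condExp hsol.measurable_jointPath
    (isEnvironmentTransition_responseProb hF hF0 hF1) responseProb_shift
    hYX.measurePreserving_map_jointPath (fun t => hF.comp (hsol.measurable_latent t))
    (fun _ _ => hF0 _) (fun _ _ => hF1 _) hsol.condProb hlim

end IsSolution

end IsSolution

end BinaryAutoregression

open BinaryAutoregression in
theorem proposition2_general {d : ℕ} (F : ℝ → ℝ) (hF_pos : ∀ x, 0 < F x) (hF_le : ∀ x, F x ≤ 1)
    (hF_lip : ∃ L, LipschitzWith L F) (q p : ℕ) (β α : ℕ → ℝ) (γ : EuclideanSpace ℝ (Fin d))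
    (hβ : ∀ z : ℂ, 1 - ∑ j ∈ Finset.Icc 1 q, (β j : ℂ) * z ^ j = 0 → 1 < ‖z‖)
    {Ω₀ : Type u} [MeasurableSpace Ω₀] (P₀ : Measure Ω₀) [IsProbabilityMeasure P₀]
    (X : ℤ → Ω₀ → EuclideanSpace ℝ (Fin d)) (hX : IsStationaryErgodic P₀ X)
    (hX_log : Integrable (fun ω => Real.posLog ‖X 1 ω‖) P₀) :
    ∃ (P : Measure ((ℤ → Fin 2) × Ω₀)) (μ : ℤ → (ℤ → Fin 2) × Ω₀ → ℝ),
      IsProbabilityMeasure P ∧ P.map Prod.snd = P₀ ∧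
      IsSolution F q p β α γ P (fun t ω => X t ω.2) (fun t ω => ω.1 t) μ ∧
      IsStationary P (fun t ω => (ω.1 t, X t ω.2, μ t ω)) ∧
      IsStationaryErgodic P (fun t ω => (ω.1 t, X t ω.2)) ∧
      ∀ (Ω' : Type v) [MeasurableSpace Ω'] (P' : Measure Ω') [IsProbabilityMeasure P']
        (X' : ℤ → Ω' → EuclideanSpace ℝ (Fin d)) (Y' : ℤ → Ω' → Fin 2) (μ' : ℤ → Ω' → ℝ),
        law P' X' = law P₀ X → IsSolution F q p β α γ P' X' Y' μ' →
        (IsStationary P' (fun t ω => (Y' t ω, X' t ω)) →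
          law P' (fun t ω => (Y' t ω, X' t ω)) = law P (fun t ω => (ω.1 t, X t ω.2))) ∧
        (IsStationary P' μ' →
          law P' (fun t ω => (Y' t ω, X' t ω, μ' t ω)) =
            law P (fun t ω => (ω.1 t, X t ω.2, μ t ω))) := by
  obtain ⟨L, hFL⟩ := hF_lip
  obtain ⟨C, ρ, hM⟩ := exists_hasPowerDecay hβ
  have hF := hFL.continuous.measurable
  have hF0 (v : ℝ) : 0 ≤ F v := (hF_pos v).le
  have hG := isEnvironmentTransition_responseProb (q := q) (p := p) (β := β) (α := α) (γ := γ)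
    hF hF0 hF_le
  have htame := hX.ae_tame hX_log hM.rate_pos hM.rate_lt_one
  have hforget := ae_forgets_responseProb (p := p) (α := α) (γ := γ) hX.2.toMeasurePreserving hM
    htame hF_pos hF_le hFL
  obtain ⟨P, hP, hPsnd, hPc⟩ := exists_isCompatible_map_jointPath hG hX.1
    (htame.mono fun x hx => hx.continuous_responseProb hM hF0 hF_le hFL) hforget
  have hY (t : ℤ) : Measurable fun ω : (ℤ → Fin 2) × Ω₀ => ω.1 t := by fun_prop
  have hXs (t : ℤ) : Measurable fun ω : (ℤ → Fin 2) × Ω₀ => X t ω.2 := (hX.1 t).comp measurable_snd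
  have hJ := measurable_jointPath hY hXs
  have hlaw : law P (fun t ω => X t ω.2) = law P₀ X := law_comp_snd hX.1 hPsnd
  have herg := hPc.ergodic_map_jointPath hG responseProb_shift hJ (hlaw ▸ hX.2) (hlaw ▸ hforget)
  refine ⟨P, fun t ω => latent q p β α γ t ω.1 fun s => X s ω.2, hP, hPsnd,
    hPc.isSolution_latent hF hF0 hF_le hM hY hXs (hlaw ▸ htame),
    isStationary_prodMk_latent hY hXs herg.toMeasurePreserving,
    isStationaryErgodic_prodMk hY hXs herg, fun Ω' _ P' _ X' Y' μ' hlaw' hsol => ?_⟩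
  rw [← hlaw'] at htame hforget
  have heq (hc : IsCompatible (responseProb F q p β α γ) (P'.map (jointPath Y' X'))) :=
    hc.map_jointPath_eq hPc hG hsol.measurable_jointPath hJ (hlaw'.trans hlaw.symm) hforget
  refine ⟨fun hYX => ?_, fun hμ => ?_⟩
  · rw [law_prodMk hsol.measurable_jointPath, law_prodMk hJ,
      heq (hsol.isCompatible_of_isStationary_response hFL hF0 hF_le hM htame hYX)]
  · rw [law_prodMk_of_eq_latent hsol.measurable_jointPath
        (hsol.ae_eq_latent_of_isStationary hM htame hμ),
      heq (hsol.isCompatible_of_isStationary_latent hF hF0 hF_le hM htame hμ),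
      law_prodMk_of_eq_latent hJ (Eventually.of_forall fun _ _ => rfl)]

theorem proposition2 {d : ℕ}
    -- the cumulative distribution function `F`
    (ν : Measure ℝ) [IsProbabilityMeasure ν] (F : ℝ → ℝ) (hF : ∀ x, F x = cdf ν x)
    (hF_pos : ∀ x, 0 < F x) (hF_lip : ∃ L, LipschitzWith L F)
    -- the parameters of the recursion
    (q p : ℕ) (β α : ℕ → ℝ) (γ : EuclideanSpace ℝ (Fin d))
    (hβ : ∀ z : ℂ, 1 - ∑ j ∈ Finset.Icc 1 q, (β j : ℂ) * z ^ j = 0 → 1 < ‖z‖)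
    -- the covariate process `X`
    {Ω₀ : Type u} [MeasurableSpace Ω₀] (P₀ : Measure Ω₀) [IsProbabilityMeasure P₀]
    (X : ℤ → Ω₀ → EuclideanSpace ℝ (Fin d))
    (hX : BinaryAutoregression.IsStationaryErgodic P₀ X)
    (hX_log : Integrable (fun ω => Real.posLog ‖X 1 ω‖) P₀) :
    -- existence, on an enlargement `{0,1}^ℤ × Ω₀` of the probability space carrying `X`,
    -- where `Y` is the coordinate process
    ∃ (P : Measure ((ℤ → Fin 2) × Ω₀)) (μ : ℤ → (ℤ → Fin 2) × Ω₀ → ℝ),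
      IsProbabilityMeasure P ∧ P.map Prod.snd = P₀ ∧
      BinaryAutoregression.IsSolution F q p β α γ P
        (fun t ω => X t ω.2) (fun t ω => ω.1 t) μ ∧
      BinaryAutoregression.IsStationary P (fun t ω => (ω.1 t, X t ω.2, μ t ω)) ∧
      BinaryAutoregression.IsStationaryErgodic P (fun t ω => (ω.1 t, X t ω.2)) ∧
      -- uniqueness in law, among solutions on all probability spaces
      ∀ (Ω' : Type v) [MeasurableSpace Ω'] (P' : Measure Ω') [IsProbabilityMeasure P']
        (X' : ℤ → Ω' → EuclideanSpace ℝ (Fin d)) (Y' : ℤ → Ω' → Fin 2) (μ' : ℤ → Ω' → ℝ),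
        BinaryAutoregression.law P' X' = BinaryAutoregression.law P₀ X →
        BinaryAutoregression.IsSolution F q p β α γ P' X' Y' μ' →
        (BinaryAutoregression.IsStationary P' (fun t ω => (Y' t ω, X' t ω)) →
          BinaryAutoregression.law P' (fun t ω => (Y' t ω, X' t ω)) =
            BinaryAutoregression.law P (fun t ω => (ω.1 t, X t ω.2))) ∧
        (BinaryAutoregression.IsStationary P' μ' →
          BinaryAutoregression.law P' (fun t ω => (Y' t ω, X' t ω, μ' t ω)) =
            BinaryAutoregression.law P (fun t ω => (ω.1 t, X t ω.2, μ t ω))) :=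
  proposition2_general F hF_pos (fun x => hF x ▸ cdf_le_one ν x) hF_lip q p β α γ hβ P₀ X hX hX_log
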